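/- Let $n\ge 1$, $0\le\alpha<2n$, $1<p_1,p_2<\infty$, $1/p=1/p_1+1/p_2$ and $1/q=1/p-\alpha/n$ with $0<q<\infty$ (no relation between $q$ and $p_1,p_2$ beyond this is assumed). A weight is a nonnegative locally integrable function on $\mathbb{R}^n$. Let $w_1,w_2,v$ be weights and set $\sigma_i=w_i^{1-p_i'}$, where $1/p_i+1/p_i'=1$, with $\sigma_i=\infty$ where $w_i=0$; assume that $\sigma_1,\sigma_2$ are weights too. Write $\sigma_i(Q)=\int_Q\sigma_i\,dx$ and $\|f\|_{L^r(w)}=(\int_{\mathbb{R}^n}|f|^r w\,dx)^{1/r}$, and define $$\mathcal{M}_\alpha(f_1,f_2)(x)=\sup_{Q\ni x}\prod_{i=1}^2\frac{1}{|Q|^{1-\alpha/(2n)}}\int_Q|f_i(y)|\,dy,$$ the supremum being over all cubes $Q\subset\mathbb{R}^n$ with sides parallel to the axes that contain $x$. Then $\mathcal{M}_\alpha$ is bounded from $L^{p_1}(w_1)\times L^{p_2}(w_2)$ to $L^q(v)$, that is, there is a finite constant $C$ such that $$\|\mathcal{M}_\alpha(f_1,f_2)\|_{L^q(v)}\le C\,\|f_1\|_{L^{p_1}(w_1)}\|f_2\|_{L^{p_2}(w_2)}\qquad\text{for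 all } f_i\in L^{p_i}(w_i),$$ if and only if both $$C_1:=\sup_{Q,\,f_2}\frac{\left(\int_Q\mathcal{M}_\alpha(\sigma_1 1_Q,\,f_2 1_Q\sigma_2)^q\,v\,dx\right)^{1/q}}{\sigma_1(Q)^{1/p_1}\,\|f_2\|_{L^{p_2}(\sigma_2)}}<\infty \quad\text{and}\quad C_2:=\sup_{Q,\,f_1}\frac{\left(\int_Q\mathcal{M}_\alpha(f_1 1_Q\sigma_1,\,1_Q\sigma_2)^q\,v\,dx\right)^{1/q}}{\|f_1\|_{L^{p_1}(\sigma_1)}\,\sigma_2(Q)^{1/p_2}}<\infty,$$ where $Q$ runs over all cubes in $\mathbb{R}^n$ with sides parallel to the axes and $f_i$ over all functions in $L^{p_i}(\sigma_i)$ of nonzero norm. -/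

import Mathlib

open MeasureTheory Set
open scoped ENNReal NNReal

noncomputable section

/-- `Q` is a (closed, nondegenerate, axis-parallel) cube in `ℝⁿ`. -/
def IsCube {n : ℕ} (Q : Set (Fin n → ℝ)) : Prop :=
  ∃ (a : Fin n → ℝ) (l : ℝ), 0 < l ∧ Q = Icc a (fun i => a i + l)

/-- A weight: a nonnegative locally integrable function. Values are taken in `[0, ∞]`;
local integrability forces them to be finite almost everywhere. -/
def IsWeight {n : ℕ} (w : (Fin n → ℝ) → ℝ≥0∞) : Prop :=
  LocallyIntegrable w volume

/-- The bilinear fractional maximal function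
`𝓜_α(f₁, f₂)(x) = sup_{Q ∋ x} ∏ᵢ |Q|^{-(1 - α/(2n))} ∫_Q |fᵢ|`. The arguments are the absolute
values `|fᵢ|`, as functions with values in `[0, ∞]`. -/
def fracMaximal {n : ℕ} (α : ℝ) (f₁ f₂ : (Fin n → ℝ) → ℝ≥0∞) (x : Fin n → ℝ) : ℝ≥0∞ :=
  ⨆ (Q : Set (Fin n → ℝ)) (_ : IsCube Q) (_ : x ∈ Q),
    ((∫⁻ y in Q, f₁ y) / volume Q ^ (1 - α / (2 * n))) *
      ((∫⁻ y in Q, f₂ y) / volume Q ^ (1 - α / (2 * n)))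

/-- The measure `w dx`. -/
def weightMeasure {n : ℕ} (w : (Fin n → ℝ) → ℝ≥0∞) : Measure (Fin n → ℝ) :=
  volume.withDensity w

/-- The dual weight `σ = w^{1 - p'}`, `1/p + 1/p' = 1` (it is `∞` where `w = 0`). -/
def dualWeight {n : ℕ} (p : ℝ) (w : (Fin n → ℝ) → ℝ≥0∞) (x : Fin n → ℝ) : ℝ≥0∞ :=
  w x ^ (1 - p.conjExponent)

/-- `𝓜_α` is bounded from `L^{p₁}(w₁) × L^{p₂}(w₂)` to `L^q(v)`. -/
def FracMaximalBounded {n : ℕ} (α p₁ p₂ q : ℝ) (w₁ w₂ v : (Fin n → ℝ) → ℝ≥0∞) : Prop :=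
  ∃ C : ℝ≥0, ∀ f₁ f₂ : (Fin n → ℝ) → ℝ,
    MemLp f₁ (ENNReal.ofReal p₁) (weightMeasure w₁) →
    MemLp f₂ (ENNReal.ofReal p₂) (weightMeasure w₂) →
    eLpNorm (fracMaximal α (fun y => ‖f₁ y‖ₑ) (fun y => ‖f₂ y‖ₑ)) (ENNReal.ofReal q)
        (weightMeasure v) ≤
      C * eLpNorm f₁ (ENNReal.ofReal p₁) (weightMeasure w₁) *
        eLpNorm f₂ (ENNReal.ofReal p₂) (weightMeasure w₂)

/-- The testing constant `C₁`: the supremum over all cubes `Q` and all `f₂ ∈ L^{p₂}(σ₂)` of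
nonzero norm of
`(∫_Q 𝓜_α(σ₁ 1_Q, f₂ 1_Q σ₂)^q v dx)^{1/q} / (σ₁(Q)^{1/p₁} ‖f₂‖_{L^{p₂}(σ₂)})`. -/
def testConst₁ {n : ℕ} (α p₁ p₂ q : ℝ) (σ₁ σ₂ v : (Fin n → ℝ) → ℝ≥0∞) : ℝ≥0∞ :=
  ⨆ (Q : Set (Fin n → ℝ)) (_ : IsCube Q) (f₂ : (Fin n → ℝ) → ℝ)
    (_ : MemLp f₂ (ENNReal.ofReal p₂) (weightMeasure σ₂))
    (_ : eLpNorm f₂ (ENNReal.ofReal p₂) (weightMeasure σ₂) ≠ 0),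
    (∫⁻ x in Q, fracMaximal α (Q.indicator σ₁)
        (Q.indicator fun y => ‖f₂ y‖ₑ * σ₂ y) x ^ q * v x) ^ (1 / q) /
      ((∫⁻ y in Q, σ₁ y) ^ (1 / p₁) * eLpNorm f₂ (ENNReal.ofReal p₂) (weightMeasure σ₂))

/-- The testing constant `C₂`: the supremum over all cubes `Q` and all `f₁ ∈ L^{p₁}(σ₁)` of
nonzero norm of
`(∫_Q 𝓜_α(f₁ 1_Q σ₁, 1_Q σ₂)^q v dx)^{1/q} / (‖f₁‖_{L^{p₁}(σ₁)} σ₂(Q)^{1/p₂})`. -/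
def testConst₂ {n : ℕ} (α p₁ p₂ q : ℝ) (σ₁ σ₂ v : (Fin n → ℝ) → ℝ≥0∞) : ℝ≥0∞ :=
  ⨆ (Q : Set (Fin n → ℝ)) (_ : IsCube Q) (f₁ : (Fin n → ℝ) → ℝ)
    (_ : MemLp f₁ (ENNReal.ofReal p₁) (weightMeasure σ₁))
    (_ : eLpNorm f₁ (ENNReal.ofReal p₁) (weightMeasure σ₁) ≠ 0),
    (∫⁻ x in Q, fracMaximal α (Q.indicator fun y => ‖f₁ y‖ₑ * σ₁ y)
        (Q.indicator σ₂) x ^ q * v x) ^ (1 / q) /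
      (eLpNorm f₁ (ENNReal.ofReal p₁) (weightMeasure σ₁) * (∫⁻ y in Q, σ₂ y) ^ (1 / p₂))

end

/-!
The substitution `f = g σ` turns the claim into a bound for `𝓜_α(g₁ σ₁, g₂ σ₂)` by the norms of
`gᵢ` in `L^{pᵢ}(σᵢ)`. Necessity of the testing conditions is then immediate: they are instances of
the bound.

For sufficiency, every cube lies in a cube of comparable size from one of `2 ^ n` shifted dyadic
grids (`exists_subset_shiftedGrid`), so it is enough to bound the maximal function over one grid
uniformly (`lintegral_fracMaximal_rpow_le`). On a grid, call a cube stopping for `gᵢ` if the mean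
value of `gᵢ` with respect to `σᵢ` has a larger dyadic scale there than on all larger cubes. Each
cube `R` lies in a stopping cube `πᵢ(R)` whose mean value is, up to a factor `2`, at least that of
`R`, and the stopping cubes satisfy a Carleson embedding
`∑_S ⟨gᵢ⟩_S ^ pᵢ σᵢ(S) ≲ ∫ gᵢ ^ pᵢ σᵢ` (`IsDyadicGrid.tsum_setLAverage_rpow_le`).

The two stopping cubes of `R` are nested. Suppose `S = π₁(R) ⊆ T = π₂(R)`; then also `π₂(S) = T`.
On `R` the function `g₂` may be replaced by `⟨g₂⟩_T`, and `g₁` by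
`G_T = sup {⟨g₁⟩_S 1_S : π₂(S) = T}`, so the testing condition on `T`, applied to `G_T`, bounds the
contribution of `T` by `⟨g₂⟩_T ^ q σ₂(T) ^ (q / p₂) (∑_{π₂(S) = T} ⟨g₁⟩_S ^ p₁ σ₁(S)) ^ (q / p₁)`.
As each `S` belongs to a single `T`, and `q / p₁ + q / p₂ = q / p ≥ 1`, Hölder's inequality and the
Carleson embedding sum these contributions (`IsDyadicGrid.lintegral_parentOrdered_le`). The other
inclusion is symmetric, with the other testing condition. No comparison of `q` with `p₁` or `p₂`
is needed, because the testing functions in one slot are arbitrary.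
-/

/-! ### Dyadic grids and stopping sets -/

/-- A dyadic grid in a measurable space: a countable family of nonempty measurable sets, any two
of which are nested or disjoint, such that every member has only finitely many ancestors. -/
structure IsDyadicGrid {Ω : Type*} [MeasurableSpace Ω] (𝒟 : Set (Set Ω)) : Prop where
  countable : 𝒟.Countable
  measurableSet : ∀ Q ∈ 𝒟, MeasurableSet Q
  nonempty : ∀ Q ∈ 𝒟, Q.Nonempty
  nested : ∀ Q ∈ 𝒟, ∀ R ∈ 𝒟, (Q ∩ R).Nonempty → Q ⊆ R ∨ R ⊆ Q
  finite_ancestors : ∀ Q ∈ 𝒟, {R ∈ 𝒟 | Q ⊆ R}.Finite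

/-- The dyadic scale of the mean value of `f` over `Q`: the integer `j` with
`2 ^ j ≤ ⨍⁻ x in Q, f x ∂ν < 2 ^ (j + 1)`, if the mean value is positive and finite. -/
noncomputable def meanLevel {Ω : Type*} [MeasurableSpace Ω] (ν : Measure Ω) (f : Ω → ℝ≥0∞)
    (Q : Set Ω) : ℤ :=
  Int.log 2 (⨍⁻ x in Q, f x ∂ν).toReal

/-- The stopping (or principal) sets of `f`: the members of the grid on which the mean value of `f`
has a larger scale than on all their strict ancestors. -/
def stoppingSets {Ω : Type*} [MeasurableSpace Ω] (𝒟 : Set (Set Ω)) (ν : Measure Ω)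
    (f : Ω → ℝ≥0∞) : Set (Set Ω) :=
  {S ∈ 𝒟 | ∫⁻ x in S, f x ∂ν ≠ 0 ∧ ∀ R ∈ 𝒟, S ⊂ R → meanLevel ν f R < meanLevel ν f S}

/-- `S` is the stopping set that controls `Q`: it contains `Q`, and no ancestor of `Q` has a mean
value of larger scale than `S`. -/
structure IsStoppingParent {Ω : Type*} [MeasurableSpace Ω] (𝒟 : Set (Set Ω)) (ν : Measure Ω)
    (f : Ω → ℝ≥0∞) (Q S : Set Ω) : Prop where
  mem : S ∈ stoppingSets 𝒟 ν f
  subset : Q ⊆ S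
  level_le : ∀ R ∈ 𝒟, Q ⊆ R → meanLevel ν f R ≤ meanLevel ν f S

section Stopping

variable {Ω : Type*} [MeasurableSpace Ω] {𝒟 : Set (Set Ω)} {ν : Measure Ω} {f : Ω → ℝ≥0∞}

lemma setLAverage_ne_top {Q : Set Ω} (hf : ∫⁻ x in Q, f x ∂ν ≠ ∞) :
    ⨍⁻ x in Q, f x ∂ν ≠ ∞ := by
  rw [setLAverage_eq]
  by_cases h : ν Q = 0
  · rw [setLIntegral_measure_zero _ _ h, ENNReal.zero_div]; simp
  · exact ENNReal.div_ne_top hf h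

lemma setLAverage_ne_zero {Q : Set Ω} (hν : ν Q ≠ ∞) (hf : ∫⁻ x in Q, f x ∂ν ≠ 0) :
    ⨍⁻ x in Q, f x ∂ν ≠ 0 := by
  rw [setLAverage_eq]
  exact ENNReal.div_ne_zero.2 ⟨hf, hν⟩

lemma zpow_meanLevel_le {Q : Set Ω} (h0 : ⨍⁻ x in Q, f x ∂ν ≠ 0) (hT : ⨍⁻ x in Q, f x ∂ν ≠ ∞) :
    (2 : ℝ) ^ meanLevel ν f Q ≤ (⨍⁻ x in Q, f x ∂ν).toReal := by
  simpa [meanLevel] using Int.zpow_log_le_self (b := 2) (by norm_num) (ENNReal.toReal_pos h0 hT)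

lemma lt_zpow_meanLevel {Q : Set Ω} :
    (⨍⁻ x in Q, f x ∂ν).toReal < (2 : ℝ) ^ (meanLevel ν f Q + 1) := by
  simpa [meanLevel] using Int.lt_zpow_succ_log_self (b := 2) (by norm_num) (⨍⁻ x in Q, f x ∂ν).toReal

lemma setLAverage_le_two_mul {Q S : Set Ω} (hQ : ∫⁻ x in Q, f x ∂ν ≠ ∞)
    (h0 : ⨍⁻ x in S, f x ∂ν ≠ 0) (hT : ⨍⁻ x in S, f x ∂ν ≠ ∞)
    (h : meanLevel ν f Q ≤ meanLevel ν f S) :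
    ⨍⁻ x in Q, f x ∂ν ≤ 2 * ⨍⁻ x in S, f x ∂ν := by
  rw [← ENNReal.toReal_le_toReal (setLAverage_ne_top hQ) (ENNReal.mul_ne_top (by simp) hT),
    ENNReal.toReal_mul]
  have h1 : (2 : ℝ) ^ (meanLevel ν f Q + 1) ≤ 2 ^ (meanLevel ν f S + 1) :=
    zpow_le_zpow_right₀ (by norm_num) (by lia)
  have h2 := zpow_meanLevel_le h0 hT
  rw [zpow_add₀ (by norm_num : (2 : ℝ) ≠ 0) (meanLevel ν f S), zpow_one] at h1
  have h3 := lt_zpow_meanLevel (ν := ν) (f := f) (Q := Q)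
  simp only [ENNReal.toReal_ofNat]
  linarith

/-- The parent is a largest set among the ancestors of maximal level. -/
lemma IsDyadicGrid.exists_stoppingParent (hD : IsDyadicGrid 𝒟) {Q : Set Ω} (hQ : Q ∈ 𝒟)
    (h0 : ∫⁻ x in Q, f x ∂ν ≠ 0) : ∃ S, IsStoppingParent 𝒟 ν f Q S := by
  have hfin := hD.finite_ancestors Q hQ
  obtain ⟨M, hM, hMmax⟩ := hfin.exists_maximalFor (meanLevel ν f) _ ⟨Q, hQ, Subset.rfl⟩
  obtain ⟨S, ⟨hSA, hSl⟩, hSmax⟩ :=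
    (hfin.subset (sep_subset _ fun R => meanLevel ν f R = meanLevel ν f M)).exists_maximal
      ⟨M, hM, rfl⟩
  have hle : ∀ R ∈ 𝒟, Q ⊆ R → meanLevel ν f R ≤ meanLevel ν f S := fun R hR hQR => by
    rw [hSl]
    rcases le_total (meanLevel ν f R) (meanLevel ν f M) with h | h
    · exact h
    · exact hMmax ⟨hR, hQR⟩ h
  refine ⟨S, ⟨hSA.1, fun h => h0 ?_, fun R hR hSR => ?_⟩, hSA.2, hle⟩
  · exact le_antisymm (h ▸ lintegral_mono_set hSA.2) zero_le
  · refine lt_of_le_of_ne (hle R hR (hSA.2.trans hSR.subset)) fun h => ?_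
    exact hSR.not_subset (hSmax ⟨⟨hR, hSA.2.trans hSR.subset⟩, h.trans hSl⟩ hSR.subset)

/-- Stopping sets that meet and have the same level coincide. -/
lemma IsDyadicGrid.eq_of_meanLevel_eq (hD : IsDyadicGrid 𝒟) {S T : Set Ω}
    (hS : S ∈ stoppingSets 𝒟 ν f) (hT : T ∈ stoppingSets 𝒟 ν f) (hST : (S ∩ T).Nonempty)
    (h : meanLevel ν f S = meanLevel ν f T) : S = T := by
  by_contra hne
  rcases hD.nested S hS.1 T hT.1 hST with hs | hs
  · exact absurd (hS.2.2 T hT.1 (hs.ssubset_of_ne hne)) (by lia)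
  · exact absurd (hT.2.2 S hS.1 (hs.ssubset_of_ne (Ne.symm hne))) (by lia)

lemma IsDyadicGrid.stoppingParent_unique (hD : IsDyadicGrid 𝒟) {Q S T : Set Ω} (hQ : Q ∈ 𝒟)
    (hS : IsStoppingParent 𝒟 ν f Q S) (hT : IsStoppingParent 𝒟 ν f Q T) : S = T :=
  hD.eq_of_meanLevel_eq hS.mem hT.mem ((hD.nonempty Q hQ).mono (subset_inter hS.subset hT.subset))
    (le_antisymm (hT.level_le S hS.mem.1 hS.subset) (hS.level_le T hT.mem.1 hT.subset))

/-- At least half of the integral of `f` over `S` comes from the points where `f` exceeds half its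
mean value. -/
lemma setLIntegral_le_two_mul (hfm : Measurable f) {S : Set Ω} (hS : MeasurableSet S)
    (hν : ν S ≠ ∞) (hf : ∫⁻ x in S, f x ∂ν ≠ ∞) :
    ∫⁻ x in S, f x ∂ν ≤ 2 * ∫⁻ x in S ∩ {x | ⨍⁻ y in S, f y ∂ν < 2 * f x}, f x ∂ν := by
  set a := ⨍⁻ y in S, f y ∂ν with ha
  set E := {x | a < 2 * f x} with hE
  have hEm : MeasurableSet E := measurableSet_lt measurable_const (hfm.const_mul 2)
  have hsplit := lintegral_inter_add_sdiff (μ := ν) f S hEm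
  have hY : 2 * ∫⁻ x in S \ E, f x ∂ν ≤ ∫⁻ x in S, f x ∂ν := by
    rw [← lintegral_const_mul _ hfm, ← measure_mul_setLAverage f hν, mul_comm, ← ha]
    calc ∫⁻ x in S \ E, 2 * f x ∂ν ≤ ∫⁻ x in S \ E, a ∂ν :=
          setLIntegral_mono' (hS.diff hEm) fun x hx => not_lt.1 hx.2
      _ = a * ν (S \ E) := setLIntegral_const _ _
      _ ≤ a * ν S := by gcongr; exact sdiff_subset
  have hYfin : ∫⁻ x in S \ E, f x ∂ν ≠ ∞ :=
    ne_top_of_le_ne_top hf (lintegral_mono_set sdiff_subset)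
  rw [← hsplit, two_mul, ENNReal.add_le_add_iff_right hYfin] at hY
  rw [← hsplit, two_mul]
  gcongr

/-- The constant in the Carleson embedding over stopping sets. -/
noncomputable def carlesonConst (p : ℝ) : ℝ≥0∞ :=
  2 * 4 ^ (p - 1) * ∑' i : ℕ, ((2⁻¹ : ℝ≥0∞) ^ (p - 1)) ^ i

lemma carlesonConst_ne_top {p : ℝ} (hp : 1 < p) : carlesonConst p ≠ ∞ := by
  refine ENNReal.mul_ne_top (ENNReal.mul_ne_top (by simp)
    (ENNReal.rpow_ne_top_of_nonneg (by linarith) (by simp))) ?_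
  rw [ENNReal.tsum_geometric]
  refine ENNReal.inv_ne_top.2 (tsub_pos_of_lt ?_).ne'
  exact ENNReal.rpow_lt_one (by simp) (by linarith)

/-- The levels of the stopping sets around a point are distinct, so the mean values that do not
exceed `2 * f x` are dominated by a geometric progression. -/
lemma IsDyadicGrid.tsum_indicator_le (hD : IsDyadicGrid 𝒟) {p : ℝ} (hp : 1 < p)
    (hν : ∀ Q ∈ 𝒟, ν Q ≠ ∞) (hf : ∀ Q ∈ 𝒟, ∫⁻ x in Q, f x ∂ν ≠ ∞) (x : Ω) :
    ∑' S : stoppingSets 𝒟 ν f, (S.1 ∩ {x | ⨍⁻ y in S.1, f y ∂ν < 2 * f x}).indicator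
        (fun _ => (⨍⁻ y in S.1, f y ∂ν) ^ (p - 1)) x
      ≤ (4 * f x) ^ (p - 1) * ∑' i : ℕ, ((2⁻¹ : ℝ≥0∞) ^ (p - 1)) ^ i := by
  have hp' : 0 < p - 1 := by linarith
  rcases eq_or_ne (f x) ∞ with hx | hx
  · have : ∑' i : ℕ, ((2⁻¹ : ℝ≥0∞) ^ (p - 1)) ^ i ≠ 0 := by
      intro h
      have := ENNReal.tsum_eq_zero.1 h 0
      simp at this
    rw [hx, ENNReal.mul_top (by simp), ENNReal.top_rpow_of_pos hp', ENNReal.top_mul this]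
    exact le_top
  set t : ℝ := (2 * f x).toReal with ht
  set m : ℤ := Int.log 2 t with hm
  set A : Set (stoppingSets 𝒟 ν f) := {S | x ∈ S.1 ∧ ⨍⁻ y in S.1, f y ∂ν < 2 * f x} with hA
  have h2x : 2 * f x ≠ ∞ := ENNReal.mul_ne_top (by simp) hx
  have hav0 : ∀ S : stoppingSets 𝒟 ν f, ⨍⁻ y in S.1, f y ∂ν ≠ 0 := fun S =>
    setLAverage_ne_zero (hν _ S.2.1) S.2.2.1
  have havT : ∀ S : stoppingSets 𝒟 ν f, ⨍⁻ y in S.1, f y ∂ν ≠ ∞ := fun S =>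
    setLAverage_ne_top (hf _ S.2.1)
  have hlev : ∀ S ∈ A, meanLevel ν f S.1 ≤ m := fun S hS =>
    Int.log_mono_right (ENNReal.toReal_pos (hav0 S) (havT S))
      ((ENNReal.toReal_le_toReal (havT S) h2x).2 hS.2.le)
  have hterm : ∀ S ∈ A, (⨍⁻ y in S.1, f y ∂ν) ^ (p - 1) ≤
      (4 * f x) ^ (p - 1) * ((2⁻¹ : ℝ≥0∞) ^ (p - 1)) ^ (m - meanLevel ν f S.1).toNat := by
    intro S hS
    have hle := hlev S hS
    obtain ⟨i, hi⟩ := Int.eq_ofNat_of_zero_le (sub_nonneg.2 hle)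
    have htpos : 0 < t := lt_of_lt_of_le (ENNReal.toReal_pos (hav0 S) (havT S))
      ((ENNReal.toReal_le_toReal (havT S) h2x).2 hS.2.le)
    rw [hi, Int.toNat_natCast, ← ENNReal.rpow_natCast, ← ENNReal.rpow_mul, mul_comm (p - 1),
      ENNReal.rpow_mul, ENNReal.rpow_natCast, ← ENNReal.mul_rpow_of_nonneg _ _ hp'.le]
    refine ENNReal.rpow_le_rpow ?_ hp'.le
    have h4 : 4 * f x * 2⁻¹ ^ i ≠ ∞ := by finiteness
    rw [← ENNReal.toReal_le_toReal (havT S) h4]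
    have h1 := lt_zpow_meanLevel (ν := ν) (f := f) (Q := S.1)
    have h2 : (2 : ℝ) ^ m ≤ t := by
      simpa using Int.zpow_log_le_self (b := 2) (by norm_num) htpos
    have h3 : meanLevel ν f S.1 + 1 = m + 1 - i := by lia
    have h5 : (4 * f x * 2⁻¹ ^ i).toReal = 2 * t * ((2 : ℝ) ^ i)⁻¹ := by
      rw [ht]
      simp only [ENNReal.toReal_mul, ENNReal.toReal_pow, ENNReal.toReal_inv,
        ENNReal.toReal_ofNat, inv_pow]
      ring
    rw [h5]
    refine h1.le.trans ?_
    rw [h3, zpow_sub₀ (by norm_num), zpow_add₀ (by norm_num), zpow_one, zpow_natCast,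
      div_eq_mul_inv, mul_comm ((2 : ℝ) ^ m)]
    gcongr
  have hinj : Function.Injective fun S : A => (m - meanLevel ν f S.1.1).toNat := by
    intro S T h
    have h1 := hlev S.1 S.2
    have h2 := hlev T.1 T.2
    have h3 : (m - meanLevel ν f S.1.1).toNat = (m - meanLevel ν f T.1.1).toNat := h
    exact Subtype.ext (Subtype.ext (hD.eq_of_meanLevel_eq S.1.2 T.1.2 ⟨x, S.2.1, T.2.1⟩ (by lia)))
  calc _ = ∑' S : stoppingSets 𝒟 ν f, A.indicator (fun S => (⨍⁻ y in S.1, f y ∂ν) ^ (p - 1)) S := by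
        refine tsum_congr fun S => ?_
        by_cases hS : S ∈ A
        · rw [indicator_of_mem hS, indicator_of_mem (show x ∈ S.1 ∩ _ from hS)]
        · rw [indicator_of_notMem hS, indicator_of_notMem (show x ∉ S.1 ∩ _ from hS)]
    _ = ∑' S : A, (⨍⁻ y in S.1.1, f y ∂ν) ^ (p - 1) := (tsum_subtype A _).symm
    _ ≤ ∑' S : A, (4 * f x) ^ (p - 1) *
          ((2⁻¹ : ℝ≥0∞) ^ (p - 1)) ^ (m - meanLevel ν f S.1.1).toNat :=
        ENNReal.tsum_le_tsum fun S => hterm S.1 S.2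
    _ ≤ _ := by
        rw [ENNReal.tsum_mul_left]
        gcongr
        exact ENNReal.tsum_comp_le_tsum_of_injective hinj
          (fun i => ((2⁻¹ : ℝ≥0∞) ^ (p - 1)) ^ i)

/-- The Carleson embedding for the mean values of `f` over its stopping sets. -/
theorem IsDyadicGrid.tsum_setLAverage_rpow_le (hD : IsDyadicGrid 𝒟) (hfm : Measurable f) {p : ℝ}
    (hp : 1 < p) (hν : ∀ Q ∈ 𝒟, ν Q ≠ ∞) (hf : ∀ Q ∈ 𝒟, ∫⁻ x in Q, f x ∂ν ≠ ∞) :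
    ∑' S : stoppingSets 𝒟 ν f, (⨍⁻ x in S.1, f x ∂ν) ^ p * ν S.1
      ≤ carlesonConst p * ∫⁻ x, f x ^ p ∂ν := by
  have hp' : 0 < p - 1 := by linarith
  have : Countable (stoppingSets 𝒟 ν f) := (hD.countable.mono (sep_subset _ _)).to_subtype
  set a : Set Ω → ℝ≥0∞ := fun S => ⨍⁻ x in S, f x ∂ν with ha
  set E : Set Ω → Set Ω := fun S => S ∩ {x | a S < 2 * f x} with hE
  have hEm : ∀ S : stoppingSets 𝒟 ν f, MeasurableSet (E S.1) := fun S =>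
    (hD.measurableSet _ S.2.1).inter (measurableSet_lt measurable_const (hfm.const_mul 2))
  calc ∑' S : stoppingSets 𝒟 ν f, a S.1 ^ p * ν S.1
      ≤ ∑' S : stoppingSets 𝒟 ν f,
          ∫⁻ x, 2 * f x * (E S.1).indicator (fun _ => a S.1 ^ (p - 1)) x ∂ν := by
        refine ENNReal.tsum_le_tsum fun S => ?_
        have h0 : a S.1 ≠ 0 := setLAverage_ne_zero (hν _ S.2.1) S.2.2.1
        have hT : a S.1 ≠ ∞ := setLAverage_ne_top (hf _ S.2.1)
        have h1 : a S.1 ^ p = a S.1 ^ (p - 1) * a S.1 := by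
          conv_rhs => rw [← ENNReal.rpow_one (a S.1), ← ENNReal.rpow_mul, one_mul,
            ← ENNReal.rpow_add _ _ h0 hT]
          simp
        rw [h1, mul_assoc, mul_comm (a S.1), measure_mul_setLAverage f (hν _ S.2.1)]
        have h2 : ∀ x, 2 * f x * (E S.1).indicator (fun _ => a S.1 ^ (p - 1)) x =
            (E S.1).indicator (fun x => a S.1 ^ (p - 1) * (2 * f x)) x := fun x => by
          by_cases hx : x ∈ E S.1 <;> simp [hx, mul_comm]
        simp_rw [h2]
        rw [lintegral_indicator (hEm S), lintegral_const_mul _ (hfm.const_mul 2),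
          lintegral_const_mul _ hfm]
        gcongr
        exact setLIntegral_le_two_mul hfm (hD.measurableSet _ S.2.1) (hν _ S.2.1) (hf _ S.2.1)
    _ = ∫⁻ x, ∑' S : stoppingSets 𝒟 ν f,
          2 * f x * (E S.1).indicator (fun _ => a S.1 ^ (p - 1)) x ∂ν :=
        (lintegral_tsum fun S => ((hfm.const_mul 2).mul
          (measurable_const.indicator (hEm S))).aemeasurable).symm
    _ ≤ ∫⁻ x, carlesonConst p * f x ^ p ∂ν := by
        refine lintegral_mono fun x => ?_
        rw [ENNReal.tsum_mul_left]
        refine (mul_le_mul_right (hD.tsum_indicator_le hp hν hf x) _).trans_eq ?_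
        have h1 : f x ^ p = f x * f x ^ (p - 1) := by
          conv_lhs => rw [show p = 1 + (p - 1) by ring,
            ENNReal.rpow_add_of_nonneg _ _ zero_le_one hp'.le, ENNReal.rpow_one]
        rw [h1, ENNReal.mul_rpow_of_nonneg _ _ hp'.le, carlesonConst]
        ring
    _ = _ := lintegral_const_mul _ (hfm.pow_const p)

end Stopping

/-! ### The two-weight inequality on a dyadic grid -/

/-- The maximal function at `x` of the coefficients `a R` over the sets `R ∋ x` of a family. -/
noncomputable def familyMax {Ω : Type*} (ℱ : Set (Set Ω)) (a : Set Ω → ℝ≥0∞) (x : Ω) : ℝ≥0∞ :=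
  ⨆ R ∈ ℱ, R.indicator (fun _ => a R) x

/-- The testing inequality on a dyadic grid: the bilinear maximal operator with coefficients `c`,
localized to a member `T` of the grid, applied to an arbitrary function in the first slot (with
respect to `ν₁`) and to the constant `1` in the second slot (with respect to `ν₂`). -/
def DyadicTesting {Ω : Type*} [MeasurableSpace Ω] (𝒟 : Set (Set Ω)) (c : Set Ω → ℝ≥0∞)
    (ν₁ ν₂ μ : Measure Ω) (p₁ p₂ q : ℝ) (C : ℝ≥0∞) : Prop :=
  ∀ T ∈ 𝒟, ∀ g : Ω → ℝ≥0∞, Measurable g → ∫⁻ x, g x ^ p₁ ∂ν₁ ≠ ∞ →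
    ∫⁻ x in T, familyMax {R ∈ 𝒟 | R ⊆ T} (fun R => c R * ((∫⁻ y in R, g y ∂ν₁) * ν₂ R)) x ^ q ∂μ
      ≤ C * (∫⁻ x, g x ^ p₁ ∂ν₁) ^ (q / p₁) * ν₂ T ^ (q / p₂)

section Dyadic

variable {Ω : Type*}

lemma le_familyMax {ℱ : Set (Set Ω)} (a : Set Ω → ℝ≥0∞) {R : Set Ω} (hR : R ∈ ℱ) {x : Ω}
    (hx : x ∈ R) : a R ≤ familyMax ℱ a x := by
  have := le_iSup₂ (f := fun (R : Set Ω) (_ : R ∈ ℱ) => R.indicator (fun _ => a R) x) R hR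
  rwa [indicator_of_mem hx] at this

lemma familyMax_le {ℱ : Set (Set Ω)} {a : Set Ω → ℝ≥0∞} {x : Ω} {b : ℝ≥0∞}
    (h : ∀ R ∈ ℱ, x ∈ R → a R ≤ b) : familyMax ℱ a x ≤ b := by
  refine iSup₂_le fun R hR => ?_
  by_cases hx : x ∈ R
  · rw [indicator_of_mem hx]; exact h R hR hx
  · simp [hx]

variable [MeasurableSpace Ω]

lemma measurable_familyMax {ℱ : Set (Set Ω)} (hc : ℱ.Countable)
    (hm : ∀ R ∈ ℱ, MeasurableSet R) (a : Set Ω → ℝ≥0∞) : Measurable (familyMax ℱ a) :=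
  Measurable.biSup _ hc fun R hR => measurable_const.indicator (hm R hR)

lemma lintegral_familyMax_rpow_le {ℱ : Set (Set Ω)} (hc : ℱ.Countable)
    (hm : ∀ R ∈ ℱ, MeasurableSet R) (a : Set Ω → ℝ≥0∞) (ν : Measure Ω) {p : ℝ} (hp : 0 < p) :
    ∫⁻ x, familyMax ℱ a x ^ p ∂ν ≤ ∑' R : ℱ, a R.1 ^ p * ν R.1 := by
  have := hc.to_subtype
  calc ∫⁻ x, familyMax ℱ a x ^ p ∂ν
      ≤ ∫⁻ x, ∑' R : ℱ, R.1.indicator (fun _ => a R.1 ^ p) x ∂ν := by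
        refine lintegral_mono fun x => ?_
        rw [← ENNReal.le_rpow_inv_iff hp]
        refine familyMax_le fun R hR hx => ?_
        rw [ENNReal.le_rpow_inv_iff hp]
        refine le_trans ?_ (ENNReal.le_tsum ⟨R, hR⟩)
        rw [indicator_of_mem hx]
    _ = _ := by
        refine (lintegral_tsum fun R : ℱ =>
          (measurable_const.indicator (hm R.1 R.2)).aemeasurable).trans ?_
        exact tsum_congr fun R => lintegral_indicator_const (hm R.1 R.2) _

/-- Hölder's inequality for sums with exponents `s + t ≥ 1`. The case `s + t > 1` follows from
`ℓ¹ ⊆ ℓ^(s + t)`. -/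
lemma tsum_rpow_mul_rpow_le {ι : Type*} (a b : ι → ℝ≥0∞) {s t : ℝ} (hs : 0 < s) (ht : 0 < t)
    (hst : 1 ≤ s + t) : ∑' i, a i ^ s * b i ^ t ≤ (∑' i, a i) ^ s * (∑' i, b i) ^ t := by
  have hpos : 0 < s + t := by linarith
  have hsum : ∀ u : ι → ℝ≥0∞, ∑' i, u i ^ (s + t) ≤ (∑' i, u i) ^ (s + t) := by
    intro u
    have h1 : ∀ z : ℝ≥0∞, z ^ (s + t) = z * z ^ (s + t - 1) := fun z => by
      conv_lhs => rw [show s + t = 1 + (s + t - 1) by ring,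
        ENNReal.rpow_add_of_nonneg _ _ zero_le_one (by linarith), ENNReal.rpow_one]
    simp_rw [h1]
    rw [← ENNReal.tsum_mul_right]
    exact ENNReal.tsum_le_tsum fun i => mul_le_mul_right
      (ENNReal.rpow_le_rpow (ENNReal.le_tsum i) (by linarith)) _
  let _ : MeasurableSpace ι := ⊤
  have holder := ENNReal.lintegral_mul_norm_pow_le (μ := Measure.count) (f := a) (g := b)
    (measurable_from_top).aemeasurable (measurable_from_top).aemeasurable
    (p := s / (s + t)) (q := t / (s + t)) (by positivity) (by positivity)
    (by field_simp)
  simp only [lintegral_count] at holder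
  have hexp : ∀ (u v : ℝ≥0∞),
      u ^ s * v ^ t = (u ^ (s / (s + t)) * v ^ (t / (s + t))) ^ (s + t) := fun u v => by
    rw [ENNReal.mul_rpow_of_nonneg _ _ hpos.le, ← ENNReal.rpow_mul, ← ENNReal.rpow_mul,
      div_mul_cancel₀ _ hpos.ne', div_mul_cancel₀ _ hpos.ne']
  simp_rw [hexp]
  exact (hsum _).trans (ENNReal.rpow_le_rpow holder hpos.le)

variable {𝒟 : Set (Set Ω)}

/-- The sets `R` of the grid whose stopping parent for `f₁` is contained in the one for `f₂`. -/
def parentOrderedSets (𝒟 : Set (Set Ω)) (ν₁ ν₂ : Measure Ω) (f₁ f₂ : Ω → ℝ≥0∞) : Set (Set Ω) :=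
  {R ∈ 𝒟 | ∃ S T, IsStoppingParent 𝒟 ν₁ f₁ R S ∧ IsStoppingParent 𝒟 ν₂ f₂ R T ∧ S ⊆ T}

/-- The part of the bilinear maximal function where the stopping parent `S` for `f₁` lies inside the
stopping parent `T` for `f₂`. Grouping by `T`, the function `f₂` is replaced by a constant and `f₁`
by the maximal function of its mean values over those `S` whose own parent for `f₂` is `T`; each `S`
is then used for one `T` only, so that the testing bounds can be summed. -/
theorem IsDyadicGrid.lintegral_parentOrdered_le (hD : IsDyadicGrid 𝒟) {c : Set Ω → ℝ≥0∞}
    {ν₁ ν₂ μ : Measure Ω} {f₁ f₂ : Ω → ℝ≥0∞} (hfm₁ : Measurable f₁) (hfm₂ : Measurable f₂)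
    {p₁ p₂ q : ℝ} (hp₁ : 1 < p₁) (hp₂ : 1 < p₂) (hq : 0 < q) (hpq : 1 ≤ q / p₂ + q / p₁)
    (hν₁ : ∀ Q ∈ 𝒟, ν₁ Q ≠ ∞) (hν₂ : ∀ Q ∈ 𝒟, ν₂ Q ≠ ∞)
    (hf₁ : ∀ Q ∈ 𝒟, ∫⁻ x in Q, f₁ x ∂ν₁ ≠ ∞) (hf₂ : ∀ Q ∈ 𝒟, ∫⁻ x in Q, f₂ x ∂ν₂ ≠ ∞)
    (hI₁ : ∫⁻ x, f₁ x ^ p₁ ∂ν₁ ≠ ∞)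
    {C : ℝ≥0∞} (hC : DyadicTesting 𝒟 c ν₁ ν₂ μ p₁ p₂ q C) :
    ∫⁻ x, familyMax (parentOrderedSets 𝒟 ν₁ ν₂ f₁ f₂)
        (fun R => c R * ((∫⁻ y in R, f₁ y ∂ν₁) * ∫⁻ y in R, f₂ y ∂ν₂)) x ^ q ∂μ
      ≤ 4 ^ q * C * (carlesonConst p₂ * ∫⁻ x, f₂ x ^ p₂ ∂ν₂) ^ (q / p₂) *
        (carlesonConst p₁ * ∫⁻ x, f₁ x ^ p₁ ∂ν₁) ^ (q / p₁) := by
  classical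
  have hp₁0 : 0 < p₁ := by linarith
  have hp₂0 : 0 < p₂ := by linarith
  have hsub₁ : stoppingSets 𝒟 ν₁ f₁ ⊆ 𝒟 := sep_subset _ _
  have hsub₂ : stoppingSets 𝒟 ν₂ f₂ ⊆ 𝒟 := sep_subset _ _
  have hc₂ : Countable (stoppingSets 𝒟 ν₂ f₂) := (hD.countable.mono hsub₂).to_subtype
  set A₁ : Set Ω → ℝ≥0∞ := fun S => ⨍⁻ x in S, f₁ x ∂ν₁ with hA₁
  set A₂ : Set Ω → ℝ≥0∞ := fun S => ⨍⁻ x in S, f₂ x ∂ν₂ with hA₂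
  set ℱ : Set Ω → Set (Set Ω) :=
    fun T => {S ∈ stoppingSets 𝒟 ν₁ f₁ | IsStoppingParent 𝒟 ν₂ f₂ S T} with hℱ
  have hℱD : ∀ T, ℱ T ⊆ 𝒟 := fun T => (sep_subset _ _).trans hsub₁
  set g : Set Ω → Ω → ℝ≥0∞ := fun T => familyMax (ℱ T) A₁ with hg
  have hgm : ∀ T, Measurable (g T) := fun T =>
    measurable_familyMax (hD.countable.mono (hℱD T)) (fun R hR => hD.measurableSet R (hℱD T hR)) _
  set U : Set Ω → Ω → ℝ≥0∞ := fun T =>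
    familyMax {R ∈ 𝒟 | R ⊆ T} (fun R => c R * ((∫⁻ y in R, g T y ∂ν₁) * ν₂ R)) with hU
  have hUm : ∀ T, Measurable (U T) := fun T =>
    measurable_familyMax (hD.countable.mono (sep_subset _ _))
      (fun R hR => hD.measurableSet R hR.1) _
  set b : Set Ω → ℝ≥0∞ := fun T => ∑' S : stoppingSets 𝒟 ν₁ f₁,
    if IsStoppingParent 𝒟 ν₂ f₂ S.1 T then A₁ S.1 ^ p₁ * ν₁ S.1 else 0 with hb
  have hgb : ∀ T, ∫⁻ x, g T x ^ p₁ ∂ν₁ ≤ b T := by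
    intro T
    refine (lintegral_familyMax_rpow_le (hD.countable.mono (hℱD T))
      (fun R hR => hD.measurableSet R (hℱD T hR)) A₁ ν₁ hp₁0).trans ?_
    let ι : ℱ T → stoppingSets 𝒟 ν₁ f₁ := fun S => ⟨S.1, S.2.1⟩
    have hι : Function.Injective ι := fun S S' h => Subtype.ext (congrArg (fun z => z.1) h)
    refine le_trans (le_of_eq (tsum_congr fun S => ?_))
      (ENNReal.tsum_comp_le_tsum_of_injective hι _)
    rw [if_pos S.2.2]
  have hbsum : ∑' T : stoppingSets 𝒟 ν₂ f₂, b T.1 ≤ carlesonConst p₁ * ∫⁻ x, f₁ x ^ p₁ ∂ν₁ := by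
    refine le_trans ?_ (hD.tsum_setLAverage_rpow_le hfm₁ hp₁ hν₁ hf₁)
    rw [hb, ENNReal.tsum_comm]
    refine ENNReal.tsum_le_tsum fun S => ?_
    -- By uniqueness of the parent, each `S` contributes to at most one `T`.
    by_cases h : ∃ T : stoppingSets 𝒟 ν₂ f₂, IsStoppingParent 𝒟 ν₂ f₂ S.1 T.1
    · obtain ⟨T, hT⟩ := h
      rw [tsum_eq_single T]
      · rw [if_pos hT]
      · intro T' hne
        rw [if_neg fun hT' => hne (Subtype.ext (hD.stoppingParent_unique S.2.1 hT' hT))]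
    · push Not at h
      simp [h]
  have hgfin : ∀ T ∈ stoppingSets 𝒟 ν₂ f₂, ∫⁻ x, g T x ^ p₁ ∂ν₁ ≠ ∞ := fun T hT =>
    ne_top_of_le_ne_top (ENNReal.mul_ne_top (carlesonConst_ne_top hp₁) hI₁)
      ((hgb T).trans ((ENNReal.le_tsum (f := fun T : stoppingSets 𝒟 ν₂ f₂ => b T.1) ⟨T, hT⟩).trans
        hbsum))
  have key : ∀ R S T, R ∈ 𝒟 → IsStoppingParent 𝒟 ν₁ f₁ R S → IsStoppingParent 𝒟 ν₂ f₂ R T →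
      S ⊆ T → c R * ((∫⁻ y in R, f₁ y ∂ν₁) * ∫⁻ y in R, f₂ y ∂ν₂) ≤
        4 * A₂ T * (c R * ((∫⁻ y in R, g T y ∂ν₁) * ν₂ R)) := by
    intro R S T hR hS hT hST
    -- A set `R' ⊇ S` also contains `R`, so `T` is the parent of `S` for `f₂` too.
    have hSF : S ∈ ℱ T := ⟨hS.mem, hT.mem, hST, fun R' hR' h =>
      hT.level_le R' hR' (hS.subset.trans h)⟩
    have h2 : ∫⁻ y in R, f₂ y ∂ν₂ ≤ ν₂ R * (2 * A₂ T) := by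
      rw [← measure_mul_setLAverage f₂ (hν₂ R hR)]
      gcongr
      exact setLAverage_le_two_mul (hf₂ R hR) (setLAverage_ne_zero (hν₂ T hT.mem.1) hT.mem.2.1)
        (setLAverage_ne_top (hf₂ T hT.mem.1)) (hT.level_le R hR Subset.rfl)
    have h1 : ∫⁻ y in R, f₁ y ∂ν₁ ≤ 2 * ∫⁻ y in R, g T y ∂ν₁ := by
      rw [← measure_mul_setLAverage f₁ (hν₁ R hR), ← lintegral_const_mul _ (hgm T)]
      calc ν₁ R * ⨍⁻ x in R, f₁ x ∂ν₁ ≤ ν₁ R * (2 * A₁ S) := by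
            gcongr
            exact setLAverage_le_two_mul (hf₁ R hR)
              (setLAverage_ne_zero (hν₁ S hS.mem.1) hS.mem.2.1)
              (setLAverage_ne_top (hf₁ S hS.mem.1)) (hS.level_le R hR Subset.rfl)
        _ = ∫⁻ _ in R, 2 * A₁ S ∂ν₁ := by rw [setLIntegral_const, mul_comm]
        _ ≤ ∫⁻ y in R, 2 * g T y ∂ν₁ :=
            setLIntegral_mono' (hD.measurableSet R hR) fun y hy =>
              mul_le_mul_right (le_familyMax A₁ hSF (hS.subset hy)) _
    calc c R * ((∫⁻ y in R, f₁ y ∂ν₁) * ∫⁻ y in R, f₂ y ∂ν₂)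
        ≤ c R * ((2 * ∫⁻ y in R, g T y ∂ν₁) * (ν₂ R * (2 * A₂ T))) := by gcongr
      _ = _ := by ring
  calc ∫⁻ x, familyMax (parentOrderedSets 𝒟 ν₁ ν₂ f₁ f₂)
        (fun R => c R * ((∫⁻ y in R, f₁ y ∂ν₁) * ∫⁻ y in R, f₂ y ∂ν₂)) x ^ q ∂μ
      ≤ ∫⁻ x, ∑' T : stoppingSets 𝒟 ν₂ f₂,
          T.1.indicator (fun x => (4 * A₂ T.1) ^ q * U T.1 x ^ q) x ∂μ := by
        refine lintegral_mono fun x => ?_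
        rw [← ENNReal.le_rpow_inv_iff hq]
        refine familyMax_le fun R hR hx => ?_
        obtain ⟨hRD, S, T, hS, hT, hST⟩ := hR
        rw [ENNReal.le_rpow_inv_iff hq]
        refine le_trans ?_ (ENNReal.le_tsum ⟨T, hT.mem⟩)
        rw [indicator_of_mem (hT.subset hx), ← ENNReal.mul_rpow_of_nonneg _ _ hq.le]
        refine ENNReal.rpow_le_rpow ((key R S T hRD hS hT hST).trans ?_) hq.le
        gcongr
        exact le_familyMax (fun R => c R * ((∫⁻ y in R, g T y ∂ν₁) * ν₂ R))
          (⟨hRD, hT.subset⟩ : R ∈ {R ∈ 𝒟 | R ⊆ T}) hx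
    _ = ∑' T : stoppingSets 𝒟 ν₂ f₂, (4 * A₂ T.1) ^ q * ∫⁻ x in T.1, U T.1 x ^ q ∂μ := by
        refine (lintegral_tsum fun T : stoppingSets 𝒟 ν₂ f₂ => ((((hUm T.1).pow_const q).const_mul _).indicator
          (hD.measurableSet T.1 T.2.1)).aemeasurable).trans ?_
        refine tsum_congr fun T => ?_
        rw [lintegral_indicator (hD.measurableSet T.1 T.2.1),
          lintegral_const_mul _ ((hUm T.1).pow_const q)]
    _ ≤ ∑' T : stoppingSets 𝒟 ν₂ f₂,
          4 ^ q * C * ((A₂ T.1 ^ p₂ * ν₂ T.1) ^ (q / p₂) * b T.1 ^ (q / p₁)) := by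
        refine ENNReal.tsum_le_tsum fun T => ?_
        have h1 : (A₂ T.1 ^ p₂ * ν₂ T.1) ^ (q / p₂) = A₂ T.1 ^ q * ν₂ T.1 ^ (q / p₂) := by
          rw [ENNReal.mul_rpow_of_nonneg _ _ (by positivity), ← ENNReal.rpow_mul,
            mul_div_cancel₀ _ hp₂0.ne']
        have h2 := hC T.1 T.2.1 (g T.1) (hgm T.1) (hgfin T.1 T.2)
        rw [h1, ENNReal.mul_rpow_of_nonneg _ _ hq.le]
        calc 4 ^ q * A₂ T.1 ^ q * ∫⁻ x in T.1, U T.1 x ^ q ∂μ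
            ≤ 4 ^ q * A₂ T.1 ^ q *
                (C * (b T.1) ^ (q / p₁) * ν₂ T.1 ^ (q / p₂)) := by
              gcongr
              refine h2.trans ?_
              gcongr
              exact hgb T.1
          _ = _ := by ring
    _ ≤ 4 ^ q * C * ((carlesonConst p₂ * ∫⁻ x, f₂ x ^ p₂ ∂ν₂) ^ (q / p₂) *
          (carlesonConst p₁ * ∫⁻ x, f₁ x ^ p₁ ∂ν₁) ^ (q / p₁)) := by
        rw [ENNReal.tsum_mul_left]
        gcongr
        refine (tsum_rpow_mul_rpow_le _ _ (by positivity) (by positivity) hpq).trans ?_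
        gcongr
        exact hD.tsum_setLAverage_rpow_le hfm₂ hp₂ hν₂ hf₂
    _ = _ := by ring

lemma setLIntegral_ne_top_of_rpow {ν : Measure Ω} {f : Ω → ℝ≥0∞} {p : ℝ} (hp : 1 < p)
    (hI : ∫⁻ x, f x ^ p ∂ν ≠ ∞) {Q : Set Ω} (hQ : ν Q ≠ ∞) : ∫⁻ x in Q, f x ∂ν ≠ ∞ := by
  have h : ∀ x, f x ≤ 1 + f x ^ p := fun x => by
    rcases le_total (f x) 1 with h | h
    · exact h.trans le_self_add
    · calc f x = f x ^ (1 : ℝ) := (ENNReal.rpow_one _).symm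
        _ ≤ f x ^ p := ENNReal.rpow_le_rpow_of_exponent_le h hp.le
        _ ≤ _ := le_add_self
  refine ne_top_of_le_ne_top ?_ (lintegral_mono h)
  rw [lintegral_add_left measurable_const]
  refine ENNReal.add_ne_top.2 ⟨by simpa using hQ, ?_⟩
  exact ne_top_of_le_ne_top hI (setLIntegral_le_lintegral _ _)

/-- The two-weight bilinear maximal inequality on a dyadic grid: testing in either slot suffices,
since of the stopping parents of a set for `f₁` and for `f₂` one contains the other. -/
theorem IsDyadicGrid.lintegral_familyMax_le (hD : IsDyadicGrid 𝒟) {c : Set Ω → ℝ≥0∞}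
    {ν₁ ν₂ μ : Measure Ω} {f₁ f₂ : Ω → ℝ≥0∞} (hfm₁ : Measurable f₁) (hfm₂ : Measurable f₂)
    {p₁ p₂ q : ℝ} (hp₁ : 1 < p₁) (hp₂ : 1 < p₂) (hq : 0 < q) (hpq : 1 ≤ q / p₁ + q / p₂)
    (hν₁ : ∀ Q ∈ 𝒟, ν₁ Q ≠ ∞) (hν₂ : ∀ Q ∈ 𝒟, ν₂ Q ≠ ∞)
    (hI₁ : ∫⁻ x, f₁ x ^ p₁ ∂ν₁ ≠ ∞) (hI₂ : ∫⁻ x, f₂ x ^ p₂ ∂ν₂ ≠ ∞)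
    {C₁ C₂ : ℝ≥0∞} (hC₁ : DyadicTesting 𝒟 c ν₂ ν₁ μ p₂ p₁ q C₁)
    (hC₂ : DyadicTesting 𝒟 c ν₁ ν₂ μ p₁ p₂ q C₂) :
    ∫⁻ x, familyMax 𝒟 (fun R => c R * ((∫⁻ y in R, f₁ y ∂ν₁) * ∫⁻ y in R, f₂ y ∂ν₂)) x ^ q ∂μ
      ≤ 4 ^ q * (C₁ + C₂) * (carlesonConst p₁ * ∫⁻ x, f₁ x ^ p₁ ∂ν₁) ^ (q / p₁) *
        (carlesonConst p₂ * ∫⁻ x, f₂ x ^ p₂ ∂ν₂) ^ (q / p₂) := by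
  have hf₁ : ∀ Q ∈ 𝒟, ∫⁻ x in Q, f₁ x ∂ν₁ ≠ ∞ := fun Q hQ =>
    setLIntegral_ne_top_of_rpow hp₁ hI₁ (hν₁ Q hQ)
  have hf₂ : ∀ Q ∈ 𝒟, ∫⁻ x in Q, f₂ x ∂ν₂ ≠ ∞ := fun Q hQ =>
    setLIntegral_ne_top_of_rpow hp₂ hI₂ (hν₂ Q hQ)
  set a : Set Ω → ℝ≥0∞ := fun R => c R * ((∫⁻ y in R, f₁ y ∂ν₁) * ∫⁻ y in R, f₂ y ∂ν₂) with ha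
  have ha' : (fun R => c R * ((∫⁻ y in R, f₂ y ∂ν₂) * ∫⁻ y in R, f₁ y ∂ν₁)) = a := by
    funext R; rw [ha, mul_comm (∫⁻ y in R, f₂ y ∂ν₂)]
  have h₂ := hD.lintegral_parentOrdered_le hfm₁ hfm₂ hp₁ hp₂ hq (by linarith) hν₁ hν₂ hf₁ hf₂ hI₁ hC₂
  have h₁ := hD.lintegral_parentOrdered_le hfm₂ hfm₁ hp₂ hp₁ hq hpq hν₂ hν₁ hf₂ hf₁ hI₂ hC₁
  rw [ha'] at h₁
  have hm : Measurable (familyMax (parentOrderedSets 𝒟 ν₂ ν₁ f₂ f₁) a) :=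
    measurable_familyMax (hD.countable.mono (sep_subset _ _))
      (fun R hR => hD.measurableSet R hR.1) _
  calc ∫⁻ x, familyMax 𝒟 a x ^ q ∂μ
      ≤ ∫⁻ x, (familyMax (parentOrderedSets 𝒟 ν₂ ν₁ f₂ f₁) a x ^ q +
          familyMax (parentOrderedSets 𝒟 ν₁ ν₂ f₁ f₂) a x ^ q) ∂μ := by
        refine lintegral_mono fun x => ?_
        rw [← ENNReal.le_rpow_inv_iff hq]
        refine familyMax_le fun R hR hx => ?_
        rw [ENNReal.le_rpow_inv_iff hq]
        by_cases h0 : a R = 0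
        · rw [h0, ENNReal.zero_rpow_of_pos hq]; exact zero_le
        have h1 : ∫⁻ y in R, f₁ y ∂ν₁ ≠ 0 := fun h => h0 (by simp [ha, h])
        have h2 : ∫⁻ y in R, f₂ y ∂ν₂ ≠ 0 := fun h => h0 (by simp [ha, h])
        obtain ⟨S, hS⟩ := hD.exists_stoppingParent hR h1
        obtain ⟨T, hT⟩ := hD.exists_stoppingParent hR h2
        rcases hD.nested S hS.mem.1 T hT.mem.1 ⟨x, hS.subset hx, hT.subset hx⟩ with h | h
        · refine le_trans (ENNReal.rpow_le_rpow ?_ hq.le) le_add_self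
          exact le_familyMax a (⟨hR, S, T, hS, hT, h⟩ : R ∈ parentOrderedSets 𝒟 ν₁ ν₂ f₁ f₂) hx
        · refine le_trans (ENNReal.rpow_le_rpow ?_ hq.le) le_self_add
          exact le_familyMax a (⟨hR, T, S, hT, hS, h⟩ : R ∈ parentOrderedSets 𝒟 ν₂ ν₁ f₂ f₁) hx
    _ ≤ _ := by
        rw [lintegral_add_left (hm.pow_const q)]
        refine (add_le_add h₁ h₂).trans_eq ?_
        ring

end Dyadic

/-! ### Shifted dyadic grids in Euclidean space -/

/-- The half-open cube of side length `h` at position `m` in the lattice `t + h ℤⁿ`. -/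
def latticeCube {n : ℕ} (t : Fin n → ℝ) (h : ℝ) (m : Fin n → ℤ) : Set (Fin n → ℝ) :=
  univ.pi fun i => Ico (t i + m i * h) (t i + m i * h + h)

/-- The translation vector of a shifted grid: `2 ^ N / 3` in the coordinates selected by `s`. -/
noncomputable def gridShift {n : ℕ} (N : ℕ) (s : Fin n → Bool) (i : Fin n) : ℝ :=
  if s i then 2 ^ N / 3 else 0

/-- The dyadic cubes of side lengths `2 ^ N / 2 ^ k`, `k = 0, 1, 2, …`, translated by
`gridShift N s`. Side lengths are bounded above, so that every cube has finitely many ancestors. -/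
def shiftedGrid {n : ℕ} (N : ℕ) (s : Fin n → Bool) : Set (Set (Fin n → ℝ)) :=
  range fun z : ℕ × (Fin n → ℤ) => latticeCube (gridShift N s) (2 ^ N / 2 ^ z.1) z.2

section Grid

variable {n : ℕ}

lemma mem_latticeCube {t : Fin n → ℝ} {h : ℝ} (hh : 0 < h) {m : Fin n → ℤ} {x : Fin n → ℝ} :
    x ∈ latticeCube t h m ↔ ∀ i, ⌊(x i - t i) / h⌋ = m i := by
  simp only [latticeCube, mem_univ_pi, mem_Ico, Int.floor_eq_iff, le_div_iff₀ hh, div_lt_iff₀ hh]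
  refine forall_congr' fun i => ⟨fun H => ⟨?_, ?_⟩, fun H => ⟨?_, ?_⟩⟩ <;> linarith [H.1, H.2]

lemma volume_latticeCube (t : Fin n → ℝ) (h : ℝ) (m : Fin n → ℤ) :
    volume (latticeCube t h m) = ENNReal.ofReal h ^ n := by
  simp [latticeCube, Real.volume_pi_Ico]

lemma volume_Icc_cube (a : Fin n → ℝ) (l : ℝ) :
    volume (Icc a fun i => a i + l) = ENNReal.ofReal l ^ n := by
  simp [Real.volume_Icc_pi]

lemma exists_isCube_of_latticeCube (t : Fin n → ℝ) {h : ℝ} (hh : 0 < h) (m : Fin n → ℤ) :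
    ∃ Q, IsCube Q ∧ latticeCube t h m ⊆ Q ∧ latticeCube t h m =ᵐ[volume] Q := by
  refine ⟨Icc (fun i => t i + m i * h) (fun i => t i + m i * h + h), ⟨_, h, hh, rfl⟩, ?_, ?_⟩
  · rw [← pi_univ_Icc]
    exact pi_mono fun i _ => Ico_subset_Icc_self
  · exact Measure.univ_pi_Ico_ae_eq_Icc

lemma latticeCube_subset {t : Fin n → ℝ} {h : ℝ} (hh : 0 < h) (d : ℕ) {m m' : Fin n → ℤ}
    (hne : (latticeCube t (h * 2 ^ d) m ∩ latticeCube t h m').Nonempty) :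
    latticeCube t h m' ⊆ latticeCube t (h * 2 ^ d) m := by
  have hh' : 0 < h * 2 ^ d := by positivity
  obtain ⟨x, hx, hx'⟩ := hne
  intro y hy
  rw [mem_latticeCube hh'] at hx ⊢
  rw [mem_latticeCube hh] at hx' hy
  intro i
  have key : ∀ z : ℝ, ⌊z / (h * 2 ^ d)⌋ = ⌊z / h⌋ / ((2 ^ d : ℕ) : ℤ) := fun z => by
    rw [← Int.floor_div_natCast, div_div]; push_cast; rfl
  rw [← hx i, key, key, hy i, hx' i]

theorem isDyadicGrid_shiftedGrid (hn : n ≠ 0) (N : ℕ) (s : Fin n → Bool) :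
    IsDyadicGrid (shiftedGrid N s) where
  countable := countable_range _
  measurableSet := by
    rintro _ ⟨z, rfl⟩
    exact MeasurableSet.univ_pi fun i => measurableSet_Ico
  nonempty := by
    rintro _ ⟨z, rfl⟩
    refine univ_pi_nonempty_iff.2 fun i => nonempty_Ico.2 ?_
    have : (0 : ℝ) < 2 ^ N / 2 ^ z.1 := by positivity
    linarith
  nested := by
    have key : ∀ (z z' : ℕ × (Fin n → ℤ)), z.1 ≤ z'.1 →
        (latticeCube (gridShift N s) (2 ^ N / 2 ^ z.1) z.2 ∩
          latticeCube (gridShift N s) (2 ^ N / 2 ^ z'.1) z'.2).Nonempty →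
        latticeCube (gridShift N s) (2 ^ N / 2 ^ z'.1) z'.2 ⊆
          latticeCube (gridShift N s) (2 ^ N / 2 ^ z.1) z.2 := by
      intro z z' hzz hne
      obtain ⟨d, hd⟩ := Nat.exists_eq_add_of_le hzz
      have : (2 : ℝ) ^ N / 2 ^ z.1 = 2 ^ N / 2 ^ z'.1 * 2 ^ d := by
        rw [hd, pow_add]; field_simp
      rw [this] at hne ⊢
      exact latticeCube_subset (by positivity) d hne
    rintro _ ⟨z, rfl⟩ _ ⟨z', rfl⟩ hne
    rcases le_total z.1 z'.1 with h | h
    · exact Or.inr (key z z' h hne)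
    · exact Or.inl (key z' z h (by rwa [inter_comm]))
  finite_ancestors := by
    rintro _ ⟨⟨k, m⟩, rfl⟩
    dsimp only
    have hh : ∀ k : ℕ, (0 : ℝ) < 2 ^ N / 2 ^ k := fun k => by positivity
    set x : Fin n → ℝ := fun i => gridShift N s i + m i * (2 ^ N / 2 ^ k) with hx
    have hxQ : x ∈ latticeCube (gridShift N s) (2 ^ N / 2 ^ k) m := by
      refine mem_univ_pi.2 fun i => ⟨le_rfl, ?_⟩
      linarith [hh k]
    refine ((finite_Iic k).image fun k' => latticeCube (gridShift N s) (2 ^ N / 2 ^ k')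
      fun i => ⌊(x i - gridShift N s i) / (2 ^ N / 2 ^ k')⌋).subset ?_
    rintro _ ⟨⟨⟨k', m'⟩, rfl⟩, hsub⟩
    dsimp only at hsub ⊢
    refine ⟨k', ?_, ?_⟩
    · have hv := measure_mono (μ := volume) hsub
      rw [volume_latticeCube, volume_latticeCube, ENNReal.pow_le_pow_left_iff hn,
        ENNReal.ofReal_le_ofReal_iff (hh k').le,
        div_le_div_iff_of_pos_left (by positivity) (by positivity) (by positivity)] at hv
      exact (pow_le_pow_iff_right₀ (by norm_num)).1 hv
    · have hm := (mem_latticeCube (hh k')).1 (hsub hxQ)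
      dsimp only
      congr 1
      funext i
      exact hm i

/-- The one-third trick: an interval shorter than a third of the mesh cannot contain a point of both
of the lattices `h ℤ` and `h ℤ + 2 ^ k h / 3`, since `3` does not divide `2 ^ k`. -/
lemma exists_floor_eq (k : ℕ) {h l : ℝ} (hh : 0 < h) (hl0 : 0 ≤ l) (hl : 3 * l ≤ h)
    (a : ℝ) :
    ∃ b : Bool, ⌊(a - if b then h * 2 ^ k / 3 else 0) / h⌋ =
      ⌊(a + l - if b then h * 2 ^ k / 3 else 0) / h⌋ := by
  by_contra hcon
  push Not at hcon
  have step : ∀ t : ℝ, ⌊(a - t) / h⌋ ≠ ⌊(a + l - t) / h⌋ →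
      a - t < ⌊(a + l - t) / h⌋ * h ∧ ⌊(a + l - t) / h⌋ * h ≤ a + l - t := by
    intro t ht
    have hlt : ⌊(a - t) / h⌋ < ⌊(a + l - t) / h⌋ :=
      lt_of_le_of_ne (Int.floor_le_floor (by gcongr; linarith)) ht
    exact ⟨(div_lt_iff₀ hh).1 (Int.floor_lt.1 hlt), (le_div_iff₀ hh).1 (Int.floor_le _)⟩
  have h0 := step 0 (by simpa using hcon false)
  have h1 := step (h * 2 ^ k / 3) (by simpa using hcon true)
  set z : ℤ := ⌊(a + l - 0) / h⌋
  set z' : ℤ := ⌊(a + l - h * 2 ^ k / 3) / h⌋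
  have e1 : ((3 * (z - z') - 2 ^ k : ℤ) : ℝ) * h < 1 * h := by push_cast; linarith [h0.2, h1.1]
  have e2 : (-1) * h < ((3 * (z - z') - 2 ^ k : ℤ) : ℝ) * h := by
    push_cast; linarith [h0.1, h1.2]
  have e3 : 3 * (z - z') - 2 ^ k < 1 := by exact_mod_cast lt_of_mul_lt_mul_right e1 hh.le
  have e4 : -1 < 3 * (z - z') - 2 ^ k := by exact_mod_cast lt_of_mul_lt_mul_right e2 hh.le
  have hdvd : (3 : ℤ) ∣ 2 ^ k := ⟨z - z', by lia⟩
  have := Int.Prime.dvd_pow' (by norm_num : Nat.Prime 3) hdvd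
  norm_num at this

/-- Every cube of side length at most `2 ^ N / 3` lies in a cube of comparable volume from one of
the `2 ^ n` shifted grids. -/
theorem exists_subset_shiftedGrid (N : ℕ) {a : Fin n → ℝ} {l : ℝ} (hl : 0 < l)
    (hlN : 3 * l ≤ 2 ^ N) :
    ∃ s : Fin n → Bool, ∃ R ∈ shiftedGrid N s, (Icc a fun i => a i + l) ⊆ R ∧
      volume R ≤ 6 ^ n * volume (Icc a fun i => a i + l) := by
  obtain ⟨k, hk1, hk2⟩ := exists_nat_pow_near (x := (2 : ℝ) ^ N / (3 * l)) (y := 2)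
    ((one_le_div (by positivity)).2 hlN) (by norm_num)
  set h : ℝ := 2 ^ N / 2 ^ k with hh
  have hpos : 0 < h := by positivity
  have h1 : 3 * l ≤ h := by
    rw [hh, le_div_iff₀ (by positivity)]
    rw [le_div_iff₀ (by positivity)] at hk1
    linarith
  have h2 : h ≤ 6 * l := by
    rw [hh, div_le_iff₀ (by positivity)]
    rw [div_lt_iff₀ (by positivity), pow_succ] at hk2
    linarith
  have hN : h * 2 ^ k = 2 ^ N := by rw [hh]; field_simp
  have hs : ∀ i, ∃ b : Bool, ⌊(a i - if b then (2 : ℝ) ^ N / 3 else 0) / h⌋ =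
      ⌊(a i + l - if b then (2 : ℝ) ^ N / 3 else 0) / h⌋ := fun i => by
    rw [← hN]; exact exists_floor_eq k hpos hl.le h1 (a i)
  choose s hs using hs
  refine ⟨s, _, ⟨(k, fun i => ⌊(a i - gridShift N s i) / h⌋), rfl⟩, fun y hy => ?_, ?_⟩
  · refine (mem_latticeCube hpos).2 fun i => le_antisymm ?_ ?_
    · have hi : ⌊(a i - gridShift N s i) / h⌋ = ⌊(a i + l - gridShift N s i) / h⌋ := hs i
      dsimp only
      rw [hi]
      exact Int.floor_le_floor (by gcongr; exact hy.2 i)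
    · exact Int.floor_le_floor (by gcongr; exact hy.1 i)
  · rw [volume_latticeCube, volume_Icc_cube, ← mul_pow]
    gcongr
    rw [← hh, show (6 : ℝ≥0∞) = ENNReal.ofReal 6 by simp, ← ENNReal.ofReal_mul (by norm_num)]
    exact ENNReal.ofReal_le_ofReal h2

end Grid

/-! ### Weights and their duals -/

section Weights

variable {n : ℕ} {w : (Fin n → ℝ) → ℝ≥0∞}

lemma IsWeight.aemeasurable (hw : IsWeight w) : AEMeasurable w volume :=
  (LocallyIntegrable.aestronglyMeasurable hw).aemeasurable

lemma IsWeight.setLIntegral_ne_top (hw : IsWeight w) {K : Set (Fin n → ℝ)} (hK : IsCompact K) :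
    ∫⁻ x in K, w x ≠ ∞ := by
  have h := (LocallyIntegrable.integrableOn_isCompact hw hK).2
  simpa [HasFiniteIntegral, lt_top_iff_ne_top] using h

lemma IsWeight.ae_ne_top (hw : IsWeight w) : ∀ᵐ x, w x ≠ ∞ := by
  have h : ∀ k : ℕ, ∀ᵐ x ∂volume.restrict (Metric.closedBall (0 : Fin n → ℝ) k), w x ≠ ∞ :=
    fun k => (ae_lt_top' hw.aemeasurable.restrict
      (hw.setLIntegral_ne_top (isCompact_closedBall 0 k))).mono fun x hx => hx.ne
  have h' := (ae_restrict_iUnion_iff (fun k : ℕ => Metric.closedBall (0 : Fin n → ℝ) k) _).2 h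
  rwa [Metric.iUnion_closedBall_nat, Measure.restrict_univ] at h'

lemma lintegral_weightMeasure (hw : IsWeight w) (g : (Fin n → ℝ) → ℝ≥0∞) :
    ∫⁻ x, g x ∂weightMeasure w = ∫⁻ x, w x * g x :=
  lintegral_withDensity_eq_lintegral_mul_non_measurable₀ _ hw.aemeasurable
    (hw.ae_ne_top.mono fun _ hx => hx.lt_top) g

lemma setLIntegral_weightMeasure (hw : IsWeight w) (g : (Fin n → ℝ) → ℝ≥0∞) {R : Set (Fin n → ℝ)}
    (hR : MeasurableSet R) : ∫⁻ x in R, g x ∂weightMeasure w = ∫⁻ x in R, w x * g x :=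
  setLIntegral_withDensity_eq_setLIntegral_mul_non_measurable₀ _ hw.aemeasurable.restrict g hR
    (ae_restrict_of_ae (hw.ae_ne_top.mono fun _ hx => hx.lt_top))

lemma volume_absolutelyContinuous_weightMeasure (hw : IsWeight w) (h0 : ∀ᵐ x, w x ≠ 0) :
    volume ≪ weightMeasure w :=
  withDensity_absolutelyContinuous' hw.aemeasurable h0

lemma weightMeasure_absolutelyContinuous : weightMeasure w ≪ volume :=
  withDensity_absolutelyContinuous _ _

lemma one_sub_conjExponent {p : ℝ} (hp : 1 < p) : 1 - p.conjExponent = -(p - 1)⁻¹ := by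
  have : p - 1 ≠ 0 := by linarith
  rw [Real.conjExponent]
  field_simp
  ring

lemma ae_ne_zero_of_dualWeight {p : ℝ} (hp : 1 < p) (hσ : IsWeight (dualWeight p w)) :
    ∀ᵐ x, w x ≠ 0 := by
  refine hσ.ae_ne_top.mono fun x hx h => hx ?_
  have : 0 < (p - 1)⁻¹ := inv_pos.2 (by linarith)
  rw [dualWeight, h, one_sub_conjExponent hp, ENNReal.zero_rpow_of_neg (by linarith)]

lemma ae_dualWeight_ne_zero {p : ℝ} (hp : 1 < p) (hw : IsWeight w) : ∀ᵐ x, dualWeight p w x ≠ 0 := by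
  refine hw.ae_ne_top.mono fun x hx h => ?_
  rcases ENNReal.rpow_eq_zero_iff.1 h with h | h
  · have h1 : 0 < (p - 1)⁻¹ := inv_pos.2 (by linarith)
    linarith [h.2, one_sub_conjExponent hp]
  · exact hx h.1

/-- Almost everywhere `σ ^ p w = σ`. -/
lemma ae_dualWeight_rpow_mul {p : ℝ} (hp : 1 < p) (hw : IsWeight w)
    (hσ : IsWeight (dualWeight p w)) :
    ∀ᵐ x, dualWeight p w x ^ p * w x = dualWeight p w x := by
  filter_upwards [hw.ae_ne_top, ae_ne_zero_of_dualWeight hp hσ] with x hT h0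
  have hp' : p - 1 ≠ 0 := by linarith
  rw [dualWeight, one_sub_conjExponent hp, ← ENNReal.rpow_mul]
  nth_rw 2 [← ENNReal.rpow_one (w x)]
  rw [← ENNReal.rpow_add _ _ h0 hT]
  congr 1
  field_simp
  ring

/-- The change of functions `f = g σ` turns the norm of `L^p(w)` into that of `L^p(σ)`. -/
lemma lintegral_div_dualWeight_rpow {p : ℝ} (hp : 1 < p) (hw : IsWeight w)
    (hσ : IsWeight (dualWeight p w)) (u : (Fin n → ℝ) → ℝ≥0∞) :
    ∫⁻ x, (u x / dualWeight p w x) ^ p ∂weightMeasure (dualWeight p w) =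
      ∫⁻ x, u x ^ p ∂weightMeasure w := by
  rw [lintegral_weightMeasure hσ, lintegral_weightMeasure hw]
  refine lintegral_congr_ae ?_
  filter_upwards [ae_dualWeight_rpow_mul hp hw hσ, ae_dualWeight_ne_zero hp hw,
    hσ.ae_ne_top] with x h h0 hT
  have hp0 : 0 ≤ p := by linarith
  rw [ENNReal.div_rpow_of_nonneg _ _ hp0]
  nth_rw 1 [← h]
  have h0' : dualWeight p w x ^ p ≠ 0 := by simp [h0, hT]
  have hT' : dualWeight p w x ^ p ≠ ∞ := ENNReal.rpow_ne_top_of_nonneg hp0 hT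
  rw [mul_comm (_ ^ p) (w x), mul_assoc, ENNReal.mul_div_cancel h0' hT']

lemma lintegral_mul_dualWeight_rpow {p : ℝ} (hp : 1 < p) (hw : IsWeight w)
    (hσ : IsWeight (dualWeight p w)) (u : (Fin n → ℝ) → ℝ≥0∞) :
    ∫⁻ x, (u x * dualWeight p w x) ^ p ∂weightMeasure w =
      ∫⁻ x, u x ^ p ∂weightMeasure (dualWeight p w) := by
  rw [lintegral_weightMeasure hσ, lintegral_weightMeasure hw]
  refine lintegral_congr_ae ?_
  filter_upwards [ae_dualWeight_rpow_mul hp hw hσ] with x h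
  have hp0 : 0 ≤ p := by linarith
  rw [ENNReal.mul_rpow_of_nonneg _ _ hp0]
  nth_rw 2 [← h]
  ring

lemma eLpNorm_ofReal_eq {Ω : Type*} [MeasurableSpace Ω] {μ : Measure Ω} {ε : Type*} [ENorm ε]
    {p : ℝ} (hp : 0 < p) (f : Ω → ε) :
    eLpNorm f (ENNReal.ofReal p) μ = (∫⁻ x, ‖f x‖ₑ ^ p ∂μ) ^ (1 / p) := by
  rw [eLpNorm_eq_lintegral_rpow_enorm_toReal (by simpa using hp) (by simp),
    ENNReal.toReal_ofReal hp.le]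

lemma eLpNorm_ofReal_rpow {Ω : Type*} [MeasurableSpace Ω] {μ : Measure Ω} {ε : Type*} [ENorm ε]
    {p : ℝ} (hp : 0 < p) (f : Ω → ε) :
    eLpNorm f (ENNReal.ofReal p) μ ^ p = ∫⁻ x, ‖f x‖ₑ ^ p ∂μ := by
  rw [eLpNorm_ofReal_eq hp, ← ENNReal.rpow_mul, one_div_mul_cancel hp.ne', ENNReal.rpow_one]

end Weights

/-! ### Comparison of the maximal function with its dyadic versions -/

section Comparison

variable {n : ℕ}

lemma IsCube.measurableSet {Q : Set (Fin n → ℝ)} (hQ : IsCube Q) : MeasurableSet Q := by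
  obtain ⟨a, l, _, rfl⟩ := hQ; exact measurableSet_Icc

lemma IsCube.isCompact {Q : Set (Fin n → ℝ)} (hQ : IsCube Q) : IsCompact Q := by
  obtain ⟨a, l, _, rfl⟩ := hQ; exact isCompact_Icc

lemma IsCube.volume_ne_zero {Q : Set (Fin n → ℝ)} (hQ : IsCube Q) : volume Q ≠ 0 := by
  obtain ⟨a, l, hl, rfl⟩ := hQ
  rw [volume_Icc_cube]
  exact pow_ne_zero _ (by simpa using hl)

lemma exists_isCube_of_mem_shiftedGrid {N : ℕ} {s : Fin n → Bool} {R : Set (Fin n → ℝ)}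
    (hR : R ∈ shiftedGrid N s) : ∃ Q, IsCube Q ∧ R ⊆ Q ∧ R =ᵐ[volume] Q := by
  obtain ⟨z, rfl⟩ := hR
  exact exists_isCube_of_latticeCube _ (by positivity) _

/-- The coefficient `|R| ^ (-2 (1 - α / (2 n)))` of the bilinear fractional maximal function. -/
noncomputable def fracCoeff (α : ℝ) (R : Set (Fin n → ℝ)) : ℝ≥0∞ :=
  (volume R ^ (1 - α / (2 * n)))⁻¹ ^ 2

lemma fracCoeff_mul (α : ℝ) (R : Set (Fin n → ℝ)) (a b : ℝ≥0∞) :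
    fracCoeff α R * (a * b) =
      (a / volume R ^ (1 - α / (2 * n))) * (b / volume R ^ (1 - α / (2 * n))) := by
  simp only [fracCoeff, div_eq_mul_inv]
  ring

lemma le_fracMaximal {α : ℝ} {g₁ g₂ : (Fin n → ℝ) → ℝ≥0∞} {x : Fin n → ℝ} {Q : Set (Fin n → ℝ)}
    (hQ : IsCube Q) (hx : x ∈ Q) :
    fracCoeff α Q * ((∫⁻ y in Q, g₁ y) * ∫⁻ y in Q, g₂ y) ≤ fracMaximal α g₁ g₂ x := by
  rw [fracCoeff_mul]
  exact le_iSup_of_le Q (le_iSup_of_le hQ (le_iSup_of_le hx le_rfl))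

lemma fracMaximal_comm (α : ℝ) (g₁ g₂ : (Fin n → ℝ) → ℝ≥0∞) :
    fracMaximal α g₁ g₂ = fracMaximal α g₂ g₁ := by
  funext x
  simp only [fracMaximal, mul_comm]

lemma fracMaximal_congr_ae (α : ℝ) {g₁ g₂ g₁' g₂' : (Fin n → ℝ) → ℝ≥0∞} (h₁ : g₁ =ᵐ[volume] g₁')
    (h₂ : g₂ =ᵐ[volume] g₂') : fracMaximal α g₁ g₂ = fracMaximal α g₁' g₂' := by
  funext x
  simp only [fracMaximal]
  refine iSup_congr fun Q => iSup_congr fun _ => iSup_congr fun _ => ?_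
  rw [lintegral_congr_ae (ae_restrict_of_ae h₁), lintegral_congr_ae (ae_restrict_of_ae h₂)]

lemma testConst₁_eq_testConst₂ (α p₁ p₂ q : ℝ) (σ₁ σ₂ v : (Fin n → ℝ) → ℝ≥0∞) :
    testConst₁ α p₁ p₂ q σ₁ σ₂ v = testConst₂ α p₂ p₁ q σ₂ σ₁ v := by
  simp only [testConst₁, testConst₂]
  refine iSup_congr fun Q => iSup_congr fun _ => iSup_congr fun f => iSup_congr fun _ =>
    iSup_congr fun _ => ?_
  rw [fracMaximal_comm, mul_comm (eLpNorm _ _ _)]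

/-- The constant lost by passing from a cube to a dyadic cube of at most six times its side. -/
noncomputable def gridConst (n : ℕ) (α : ℝ) : ℝ≥0∞ :=
  ((6 ^ n : ℝ≥0∞) ^ (1 - α / (2 * n))) ^ 2

lemma gridConst_ne_top {α : ℝ} (hθ : 0 ≤ 1 - α / (2 * n)) : gridConst n α ≠ ∞ :=
  ENNReal.pow_ne_top (ENNReal.rpow_ne_top_of_nonneg hθ (by simp))

lemma fracCoeff_le {α : ℝ} (hθ : 0 ≤ 1 - α / (2 * n)) {Q R : Set (Fin n → ℝ)}
    (h : volume R ≤ 6 ^ n * volume Q) : fracCoeff α Q ≤ gridConst n α * fracCoeff α R := by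
  rw [fracCoeff, fracCoeff, gridConst, ← mul_pow]
  gcongr
  have h6 : ((6 ^ n : ℝ≥0∞) ^ (1 - α / (2 * n))) ≠ 0 := by simp [ENNReal.rpow_eq_zero_iff]
  have h6' : ((6 ^ n : ℝ≥0∞) ^ (1 - α / (2 * n))) ≠ ∞ :=
    ENNReal.rpow_ne_top_of_nonneg hθ (by simp)
  have h1 := ENNReal.rpow_le_rpow h hθ
  rw [ENNReal.mul_rpow_of_nonneg _ _ hθ] at h1
  have h2 := ENNReal.inv_le_inv.2 h1
  rw [ENNReal.mul_inv (Or.inl h6) (Or.inl h6')] at h2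
  calc _ = (6 ^ n : ℝ≥0∞) ^ (1 - α / (2 * n)) * (((6 ^ n : ℝ≥0∞) ^ (1 - α / (2 * n)))⁻¹ *
        (volume Q ^ (1 - α / (2 * n)))⁻¹) := by
        rw [← mul_assoc, ENNReal.mul_inv_cancel h6 h6', one_mul]
    _ ≤ _ := by gcongr

/-- A uniform bound for the dyadic maximal functions bounds the maximal function. The top side
length `2 ^ N` tends to infinity, and Fatou's lemma gives the limit. -/
theorem lintegral_fracMaximal_rpow_le {α q : ℝ} (hθ : 0 ≤ 1 - α / (2 * n)) (hn : n ≠ 0)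
    (hq : 0 < q) (g₁ g₂ : (Fin n → ℝ) → ℝ≥0∞) (μ : Measure (Fin n → ℝ)) {B : ℝ≥0∞}
    (hB : ∀ N (s : Fin n → Bool), ∫⁻ x, familyMax (shiftedGrid N s)
      (fun R => fracCoeff α R * ((∫⁻ y in R, g₁ y) * ∫⁻ y in R, g₂ y)) x ^ q ∂μ ≤ B) :
    ∫⁻ x, fracMaximal α g₁ g₂ x ^ q ∂μ ≤ 2 ^ n * (gridConst n α ^ q * B) := by
  set F : ℕ → (Fin n → Bool) → (Fin n → ℝ) → ℝ≥0∞ := fun N s => familyMax (shiftedGrid N s)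
      (fun R => fracCoeff α R * ((∫⁻ y in R, g₁ y) * ∫⁻ y in R, g₂ y)) with hF
  have hFm : ∀ N s, Measurable (F N s) := fun N s =>
    measurable_familyMax (isDyadicGrid_shiftedGrid hn N s).countable
      (isDyadicGrid_shiftedGrid hn N s).measurableSet _
  set Z : ℕ → (Fin n → ℝ) → ℝ≥0∞ := fun N x => ∑ s, gridConst n α ^ q * F N s x ^ q with hZ
  have hZm : ∀ N, Measurable (Z N) := fun N =>
    Finset.measurable_fun_sum _ fun s _ => ((hFm N s).pow_const q).const_mul _
  have hpt : ∀ x, fracMaximal α g₁ g₂ x ^ q ≤ Filter.liminf (fun N => Z N x) Filter.atTop := by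
    intro x
    rw [← ENNReal.le_rpow_inv_iff hq]
    refine iSup_le fun Q => iSup_le fun hQ => iSup_le fun hx => ?_
    rw [ENNReal.le_rpow_inv_iff hq, ← fracCoeff_mul]
    obtain ⟨a, l, hl, rfl⟩ := hQ
    obtain ⟨N₀, hN₀⟩ := pow_unbounded_of_one_lt (3 * l) (one_lt_two : (1 : ℝ) < 2)
    refine Filter.le_liminf_of_le (by isBoundedDefault) ?_
    filter_upwards [Filter.eventually_ge_atTop N₀] with N hN
    obtain ⟨s, R, hR, hsub, hvol⟩ := exists_subset_shiftedGrid N (a := a) hl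
      (hN₀.le.trans (pow_le_pow_right₀ (by norm_num) hN))
    refine le_trans ?_ (Finset.single_le_sum (f := fun s => gridConst n α ^ q * F N s x ^ q)
      (fun _ _ => zero_le) (Finset.mem_univ s))
    rw [← ENNReal.mul_rpow_of_nonneg _ _ hq.le]
    refine ENNReal.rpow_le_rpow ?_ hq.le
    calc _ ≤ (gridConst n α * fracCoeff α R) * ((∫⁻ y in R, g₁ y) * ∫⁻ y in R, g₂ y) := by
          gcongr
          exact fracCoeff_le hθ hvol
      _ ≤ _ := by
          rw [mul_assoc]
          gcongr
          exact le_familyMax (fun R => fracCoeff α R * ((∫⁻ y in R, g₁ y) * ∫⁻ y in R, g₂ y))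
            hR (hsub hx)
  calc ∫⁻ x, fracMaximal α g₁ g₂ x ^ q ∂μ
      ≤ ∫⁻ x, Filter.liminf (fun N => Z N x) Filter.atTop ∂μ := lintegral_mono hpt
    _ ≤ Filter.liminf (fun N => ∫⁻ x, Z N x ∂μ) Filter.atTop := lintegral_liminf_le hZm
    _ ≤ Filter.liminf (fun _ : ℕ => 2 ^ n * (gridConst n α ^ q * B)) Filter.atTop := by
        refine Filter.liminf_le_liminf (Filter.Eventually.of_forall fun N => ?_)
        rw [lintegral_finsetSum _ fun s _ => ((hFm N s).pow_const q).const_mul _]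
        calc ∑ s, ∫⁻ x, gridConst n α ^ q * F N s x ^ q ∂μ
            ≤ ∑ _s : Fin n → Bool, gridConst n α ^ q * B := by
              refine Finset.sum_le_sum fun s _ => ?_
              rw [lintegral_const_mul _ ((hFm N s).pow_const q)]
              gcongr
              exact hB N s
          _ = _ := by simp
    _ = _ := Filter.liminf_const _

/-- The testing condition over cubes gives the testing inequality on each shifted grid. -/
theorem dyadicTesting_of_testConst₂ {α p₁ p₂ q : ℝ} (hp₁ : 1 < p₁) (hp₂ : 1 < p₂) (hq : 0 < q)
    {σ₁ σ₂ v : (Fin n → ℝ) → ℝ≥0∞} (hσ₁ : IsWeight σ₁) (hσ₂ : IsWeight σ₂) (hv : IsWeight v)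
    (h0 : ∀ᵐ x, σ₂ x ≠ 0) (N : ℕ) (s : Fin n → Bool) :
    DyadicTesting (shiftedGrid N s) (fracCoeff α) (weightMeasure σ₁) (weightMeasure σ₂)
      (weightMeasure v) p₁ p₂ q (testConst₂ α p₁ p₂ q σ₁ σ₂ v ^ q) := by
  have hp₁0 : 0 < p₁ := by linarith
  have hp₂0 : 0 < p₂ := by linarith
  have hmeas : ∀ R ∈ shiftedGrid N s, MeasurableSet R := by
    rintro _ ⟨z, rfl⟩
    exact MeasurableSet.univ_pi fun i => measurableSet_Ico
  intro T hT g hg hgI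
  obtain ⟨Q, hQ, hTQ, hTQae⟩ := exists_isCube_of_mem_shiftedGrid hT
  rcases eq_or_ne (∫⁻ x, g x ^ p₁ ∂weightMeasure σ₁) 0 with hI0 | hI0
  · have hg0 : g =ᵐ[weightMeasure σ₁] 0 := by
      refine ((lintegral_eq_zero_iff (hg.pow_const p₁)).1 hI0).mono fun x hx => ?_
      simpa [ENNReal.rpow_eq_zero_iff, hp₁0, hp₁0.not_gt] using hx
    have hz : ∀ x, familyMax {R ∈ shiftedGrid N s | R ⊆ T} (fun R => fracCoeff α R *
        ((∫⁻ y in R, g y ∂weightMeasure σ₁) * weightMeasure σ₂ R)) x = 0 := fun x => by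
      refine le_antisymm (familyMax_le fun R _ _ => ?_) zero_le
      rw [lintegral_congr_ae (ae_restrict_of_ae hg0)]
      simp
    simp [hz, hq]
  -- `g` is finite `σ₁`-almost everywhere, so its real-valued version is an admissible test function.
  set f : (Fin n → ℝ) → ℝ := fun y => (g y).toReal with hf
  have hfg : ∀ᵐ y ∂weightMeasure σ₁, ‖f y‖ₑ = g y := by
    refine (ae_lt_top (hg.pow_const p₁) hgI).mono fun y hy => ?_
    have : g y ≠ ∞ := fun h => by simp [h, hp₁0] at hy
    rw [hf, Real.enorm_eq_ofReal ENNReal.toReal_nonneg, ENNReal.ofReal_toReal this]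
  have hnorm : eLpNorm f (ENNReal.ofReal p₁) (weightMeasure σ₁) =
      (∫⁻ x, g x ^ p₁ ∂weightMeasure σ₁) ^ (1 / p₁) := by
    rw [eLpNorm_ofReal_eq hp₁0, lintegral_congr_ae (hfg.mono fun y hy => by rw [hy])]
  have hnorm0 : eLpNorm f (ENNReal.ofReal p₁) (weightMeasure σ₁) ≠ 0 := by
    rw [hnorm]; simp [ENNReal.rpow_eq_zero_iff, hI0, hgI]
  have hnormT : eLpNorm f (ENNReal.ofReal p₁) (weightMeasure σ₁) ≠ ∞ := by
    rw [hnorm]; exact ENNReal.rpow_ne_top_of_nonneg (by positivity) hgI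
  have hmem : MemLp f (ENNReal.ofReal p₁) (weightMeasure σ₁) :=
    ⟨hg.ennreal_toReal.aestronglyMeasurable, hnormT.lt_top⟩
  have hσT : ∫⁻ y in Q, σ₂ y ≠ ∞ := hσ₂.setLIntegral_ne_top hQ.isCompact
  have hσ0 : ∫⁻ y in Q, σ₂ y ≠ 0 := by
    intro h
    rw [lintegral_eq_zero_iff' hσ₂.aemeasurable.restrict] at h
    have hfalse : ∀ᵐ x ∂volume.restrict Q, False := by
      filter_upwards [h, ae_restrict_of_ae h0] with x h1 h2 using h2 h1
    rw [Filter.eventually_false_iff_eq_bot, ae_eq_bot, Measure.restrict_eq_zero] at hfalse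
    exact hQ.volume_ne_zero hfalse
  have hT2 : weightMeasure σ₂ T = ∫⁻ y in Q, σ₂ y := by
    rw [weightMeasure, withDensity_apply _ (hmeas T hT), Measure.restrict_congr_set hTQae]
  set M : (Fin n → ℝ) → ℝ≥0∞ := fracMaximal α (Q.indicator fun y => ‖f y‖ₑ * σ₁ y)
    (Q.indicator σ₂) with hM
  have htest : (∫⁻ x in Q, M x ^ q * v x) ^ (1 / q) ≤ testConst₂ α p₁ p₂ q σ₁ σ₂ v *
      (eLpNorm f (ENNReal.ofReal p₁) (weightMeasure σ₁) * (∫⁻ y in Q, σ₂ y) ^ (1 / p₂)) := by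
    rw [← ENNReal.div_le_iff]
    · exact le_iSup_of_le Q (le_iSup_of_le hQ (le_iSup_of_le f (le_iSup_of_le hmem
        (le_iSup_of_le hnorm0 le_rfl))))
    · exact mul_ne_zero hnorm0 (by simp [ENNReal.rpow_eq_zero_iff, hσ0, hσT])
    · exact ENNReal.mul_ne_top hnormT (ENNReal.rpow_ne_top_of_nonneg (by positivity) hσT)
  rw [one_div, ENNReal.rpow_inv_le_iff hq, ENNReal.mul_rpow_of_nonneg _ _ hq.le,
    ENNReal.mul_rpow_of_nonneg _ _ hq.le, hnorm, ← ENNReal.rpow_mul, ← ENNReal.rpow_mul,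
    one_div_mul_eq_div, one_div_mul_eq_div] at htest
  rw [hT2, mul_assoc]
  refine le_trans ?_ htest
  rw [setLIntegral_weightMeasure hv _ (hmeas T hT)]
  refine le_trans (lintegral_mono fun x => ?_) (lintegral_mono_set hTQ)
  rw [mul_comm]
  gcongr
  refine familyMax_le fun R hR hx => ?_
  obtain ⟨R', hR', hRR', hRae⟩ := exists_isCube_of_mem_shiftedGrid hR.1
  refine le_trans ?_ (le_fracMaximal hR' (hRR' hx))
  have hvol : fracCoeff α R = fracCoeff α R' := by
    rw [fracCoeff, fracCoeff, measure_congr hRae]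
  have hRm := hmeas R hR.1
  have hRQ : R ⊆ Q := hR.2.trans hTQ
  rw [hvol]
  refine mul_le_mul_right (mul_le_mul' ?_ ?_) _
  · rw [← lintegral_congr_ae (ae_restrict_of_ae hfg), setLIntegral_weightMeasure hσ₁ _ hRm]
    refine le_trans (le_of_eq (setLIntegral_congr_fun hRm fun y hy => ?_)) (lintegral_mono_set hRR')
    simp [hRQ hy, mul_comm]
  · rw [weightMeasure, withDensity_apply _ hRm]
    refine le_trans (le_of_eq (setLIntegral_congr_fun hRm fun y hy => ?_)) (lintegral_mono_set hRR')
    simp [hRQ hy]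

end Comparison

/-! ### Sufficiency and necessity of the testing conditions -/

section TwoWeight

variable {n : ℕ} {α p₁ p₂ q : ℝ} {w₁ w₂ v : (Fin n → ℝ) → ℝ≥0∞}

/-- The change of functions `f = g σ`: a function of `L^p(w)` gives a measurable `g` with
`g σ = |f|` almost everywhere, of the same norm in `L^p(σ)`. -/
lemma exists_measurable_div_dualWeight {p : ℝ} {w : (Fin n → ℝ) → ℝ≥0∞} (hp : 1 < p)
    (hw : IsWeight w) (hσ : IsWeight (dualWeight p w)) {f : (Fin n → ℝ) → ℝ}
    (hf : MemLp f (ENNReal.ofReal p) (weightMeasure w)) :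
    ∃ g : (Fin n → ℝ) → ℝ≥0∞, Measurable g ∧
      (∀ R, MeasurableSet R →
        ∫⁻ x in R, g x ∂weightMeasure (dualWeight p w) = ∫⁻ x in R, ‖f x‖ₑ) ∧
      ∫⁻ x, g x ^ p ∂weightMeasure (dualWeight p w) =
        eLpNorm f (ENNReal.ofReal p) (weightMeasure w) ^ p := by
  have hp0 : 0 < p := by linarith
  have hfm : AEMeasurable (fun x => ‖f x‖ₑ) volume :=
    (hf.1.mono_ac (volume_absolutelyContinuous_weightMeasure hw
      (ae_ne_zero_of_dualWeight hp hσ))).enorm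
  have hm : AEMeasurable (fun x => ‖f x‖ₑ / dualWeight p w x) volume := hfm.div hσ.aemeasurable
  refine ⟨hm.mk _, hm.measurable_mk, fun R hR => ?_, ?_⟩
  · rw [setLIntegral_weightMeasure hσ _ hR]
    refine lintegral_congr_ae (ae_restrict_of_ae ?_)
    filter_upwards [hm.ae_eq_mk, ae_dualWeight_ne_zero hp hw, hσ.ae_ne_top] with x h h0 hT
    rw [← h, ENNReal.mul_div_cancel h0 hT]
  · rw [eLpNorm_ofReal_rpow hp0, ← lintegral_div_dualWeight_rpow hp hw hσ]
    refine lintegral_congr_ae (weightMeasure_absolutelyContinuous.ae_le ?_)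
    filter_upwards [hm.ae_eq_mk] with x h
    rw [h]

/-- Sufficiency of the testing conditions. -/
theorem fracMaximalBounded_of_testConst (hn : n ≠ 0) (hθ : 0 ≤ 1 - α / (2 * n)) (hp₁ : 1 < p₁)
    (hp₂ : 1 < p₂) (hq : 0 < q) (hpq : 1 ≤ q / p₁ + q / p₂)
    (hw₁ : IsWeight w₁) (hw₂ : IsWeight w₂) (hv : IsWeight v)
    (hσ₁ : IsWeight (dualWeight p₁ w₁)) (hσ₂ : IsWeight (dualWeight p₂ w₂))
    (h₁ : testConst₁ α p₁ p₂ q (dualWeight p₁ w₁) (dualWeight p₂ w₂) v < ∞)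
    (h₂ : testConst₂ α p₁ p₂ q (dualWeight p₁ w₁) (dualWeight p₂ w₂) v < ∞) :
    FracMaximalBounded α p₁ p₂ q w₁ w₂ v := by
  have hp₁0 : 0 < p₁ := by linarith
  have hp₂0 : 0 < p₂ := by linarith
  set C₁ := testConst₁ α p₁ p₂ q (dualWeight p₁ w₁) (dualWeight p₂ w₂) v
  set C₂ := testConst₂ α p₁ p₂ q (dualWeight p₁ w₁) (dualWeight p₂ w₂) v
  set B : ℝ≥0∞ := 2 ^ n * (gridConst n α ^ q * (4 ^ q * (C₁ ^ q + C₂ ^ q) *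
    carlesonConst p₁ ^ (q / p₁) * carlesonConst p₂ ^ (q / p₂))) with hB
  have hBT : B ≠ ∞ := by
    have e1 := ENNReal.rpow_ne_top_of_nonneg hq.le (gridConst_ne_top hθ)
    have e2 := ENNReal.rpow_ne_top_of_nonneg hq.le h₁.ne
    have e3 := ENNReal.rpow_ne_top_of_nonneg hq.le h₂.ne
    have e4 := ENNReal.rpow_ne_top_of_nonneg (y := q / p₁) (by positivity)
      (carlesonConst_ne_top hp₁)
    have e5 := ENNReal.rpow_ne_top_of_nonneg (y := q / p₂) (by positivity)
      (carlesonConst_ne_top hp₂)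
    have e6 : (4 : ℝ≥0∞) ^ q ≠ ∞ := ENNReal.rpow_ne_top_of_nonneg hq.le (by simp)
    finiteness
  have hBT' : B ^ (1 / q) ≠ ∞ := ENNReal.rpow_ne_top_of_nonneg (by positivity) hBT
  refine ⟨(B ^ (1 / q)).toNNReal, fun f₁ f₂ hf₁ hf₂ => ?_⟩
  rw [ENNReal.coe_toNNReal hBT']
  set I₁ := eLpNorm f₁ (ENNReal.ofReal p₁) (weightMeasure w₁)
  set I₂ := eLpNorm f₂ (ENNReal.ofReal p₂) (weightMeasure w₂)
  obtain ⟨g₁, hg₁m, hg₁, hg₁I⟩ := exists_measurable_div_dualWeight hp₁ hw₁ hσ₁ hf₁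
  obtain ⟨g₂, hg₂m, hg₂, hg₂I⟩ := exists_measurable_div_dualWeight hp₂ hw₂ hσ₂ hf₂
  have hfin : ∀ {σ : (Fin n → ℝ) → ℝ≥0∞}, IsWeight σ → ∀ N (s : Fin n → Bool),
      ∀ Q ∈ shiftedGrid N s, weightMeasure σ Q ≠ ∞ := by
    intro σ hσ N s Q hQ
    have hQm := (isDyadicGrid_shiftedGrid hn N s).measurableSet Q hQ
    obtain ⟨Q', hQ', hsub, _⟩ := exists_isCube_of_mem_shiftedGrid hQ
    rw [weightMeasure, withDensity_apply _ hQm]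
    exact ne_top_of_le_ne_top (hσ.setLIntegral_ne_top hQ'.isCompact) (lintegral_mono_set hsub)
  have hgrid : ∀ N (s : Fin n → Bool), ∫⁻ x, familyMax (shiftedGrid N s)
      (fun R => fracCoeff α R * ((∫⁻ y in R, ‖f₁ y‖ₑ) * ∫⁻ y in R, ‖f₂ y‖ₑ)) x ^ q
        ∂weightMeasure v ≤
      4 ^ q * (C₁ ^ q + C₂ ^ q) * (carlesonConst p₁ * I₁ ^ p₁) ^ (q / p₁) *
        (carlesonConst p₂ * I₂ ^ p₂) ^ (q / p₂) := by
    intro N s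
    have hD := isDyadicGrid_shiftedGrid hn N s
    have hC₁ := dyadicTesting_of_testConst₂ (α := α) hp₂ hp₁ hq hσ₂ hσ₁ hv
      (ae_dualWeight_ne_zero hp₁ hw₁) N s
    have hC₂ := dyadicTesting_of_testConst₂ (α := α) hp₁ hp₂ hq hσ₁ hσ₂ hv
      (ae_dualWeight_ne_zero hp₂ hw₂) N s
    rw [← testConst₁_eq_testConst₂] at hC₁
    have hmain := hD.lintegral_familyMax_le hg₁m hg₂m hp₁ hp₂ hq hpq (hfin hσ₁ N s) (hfin hσ₂ N s)
      (hg₁I ▸ ENNReal.rpow_ne_top_of_nonneg hp₁0.le hf₁.2.ne)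
      (hg₂I ▸ ENNReal.rpow_ne_top_of_nonneg hp₂0.le hf₂.2.ne) hC₁ hC₂
    rw [hg₁I, hg₂I] at hmain
    refine le_trans (lintegral_mono fun x => ENNReal.rpow_le_rpow ?_ hq.le) hmain
    refine familyMax_le fun R hR hx => ?_
    rw [← hg₁ R (hD.measurableSet R hR), ← hg₂ R (hD.measurableSet R hR)]
    exact le_familyMax (fun R => fracCoeff α R *
      ((∫⁻ y in R, g₁ y ∂weightMeasure (dualWeight p₁ w₁)) *
        ∫⁻ y in R, g₂ y ∂weightMeasure (dualWeight p₂ w₂))) hR hx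
  have hM := lintegral_fracMaximal_rpow_le hθ hn hq _ _ (weightMeasure v) hgrid
  have hpow : ∀ (K I : ℝ≥0∞) {p : ℝ}, 0 < p →
      (K * I ^ p) ^ (q / p) = K ^ (q / p) * I ^ q := fun K I p hp => by
    rw [ENNReal.mul_rpow_of_nonneg _ _ (by positivity), ← ENNReal.rpow_mul,
      mul_div_cancel₀ _ hp.ne']
  rw [hpow _ _ hp₁0, hpow _ _ hp₂0] at hM
  rw [eLpNorm_ofReal_eq hq, one_div, ENNReal.rpow_inv_le_iff hq,
    ENNReal.mul_rpow_of_nonneg _ _ hq.le, ENNReal.mul_rpow_of_nonneg _ _ hq.le, ← ENNReal.rpow_mul,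
    inv_mul_cancel₀ hq.ne', ENNReal.rpow_one]
  simp only [enorm_eq_self]
  refine hM.trans_eq ?_
  rw [hB]
  ring

lemma FracMaximalBounded.symm (h : FracMaximalBounded α p₁ p₂ q w₁ w₂ v) :
    FracMaximalBounded α p₂ p₁ q w₂ w₁ v := by
  obtain ⟨C, hC⟩ := h
  refine ⟨C, fun f₁ f₂ hf₁ hf₂ => ?_⟩
  rw [fracMaximal_comm, mul_right_comm]
  exact hC f₂ f₁ hf₂ hf₁

/-- The function `u σ` on a cube, as a test function in `L^p(w)`. -/
lemma memLp_indicator_mul_dualWeight {p : ℝ} {w : (Fin n → ℝ) → ℝ≥0∞} (hp : 1 < p)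
    (hw : IsWeight w) (hσ : IsWeight (dualWeight p w)) {u : (Fin n → ℝ) → ℝ≥0∞}
    (hu : AEMeasurable u volume) (huT : ∀ x, u x ≠ ∞) {Q : Set (Fin n → ℝ)}
    (hQ : MeasurableSet Q)
    (hI : ∫⁻ x in Q, u x ^ p ∂weightMeasure (dualWeight p w) ≠ ∞) :
    ∃ f : (Fin n → ℝ) → ℝ, MemLp f (ENNReal.ofReal p) (weightMeasure w) ∧
      (fun x => ‖f x‖ₑ) =ᵐ[volume] Q.indicator (fun y => u y * dualWeight p w y) ∧
      eLpNorm f (ENNReal.ofReal p) (weightMeasure w) =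
        (∫⁻ x in Q, u x ^ p ∂weightMeasure (dualWeight p w)) ^ (1 / p) := by
  have hp0 : 0 < p := by linarith
  set F : (Fin n → ℝ) → ℝ≥0∞ := Q.indicator (fun y => u y * dualWeight p w y) with hF
  have hFm : AEMeasurable F volume := (hu.mul hσ.aemeasurable).indicator hQ
  have hae : (fun x => ‖(F x).toReal‖ₑ) =ᵐ[volume] F := by
    filter_upwards [hσ.ae_ne_top] with x hx
    have hFx : F x ≠ ∞ := by
      by_cases hxQ : x ∈ Q
      · simp [hF, hxQ, ENNReal.mul_ne_top (huT x) hx]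
      · simp [hF, hxQ]
    rw [Real.enorm_eq_ofReal ENNReal.toReal_nonneg, ENNReal.ofReal_toReal hFx]
  have hnorm : eLpNorm (fun x => (F x).toReal) (ENNReal.ofReal p) (weightMeasure w) =
      (∫⁻ x in Q, u x ^ p ∂weightMeasure (dualWeight p w)) ^ (1 / p) := by
    rw [eLpNorm_ofReal_eq hp0]
    congr 1
    rw [← lintegral_indicator hQ]
    have h1 : Q.indicator (fun x => u x ^ p) = fun x => Q.indicator u x ^ p := by
      funext x
      by_cases hx : x ∈ Q <;> simp [hx, hp0]
    rw [h1, ← lintegral_mul_dualWeight_rpow hp hw hσ]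
    refine lintegral_congr_ae (weightMeasure_absolutelyContinuous.ae_le ?_)
    filter_upwards [hae] with x hx
    rw [hx, hF]
    by_cases hxQ : x ∈ Q <;> simp [hxQ]
  refine ⟨fun x => (F x).toReal, ⟨?_, ?_⟩, hae, hnorm⟩
  · exact (hFm.mono_ac weightMeasure_absolutelyContinuous).ennreal_toReal.aestronglyMeasurable
  · rw [hnorm]
    exact (ENNReal.rpow_ne_top_of_nonneg (by positivity) hI).lt_top

/-- Necessity: the bound applied to `|f| σ₁ 1_Q` and `σ₂ 1_Q` is the testing inequality. -/
theorem FracMaximalBounded.testConst₂_lt_top (h : FracMaximalBounded α p₁ p₂ q w₁ w₂ v)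
    (hp₁ : 1 < p₁) (hp₂ : 1 < p₂) (hq : 0 < q)
    (hw₁ : IsWeight w₁) (hw₂ : IsWeight w₂) (hv : IsWeight v)
    (hσ₁ : IsWeight (dualWeight p₁ w₁)) (hσ₂ : IsWeight (dualWeight p₂ w₂)) :
    testConst₂ α p₁ p₂ q (dualWeight p₁ w₁) (dualWeight p₂ w₂) v < ∞ := by
  have hp₁0 : 0 < p₁ := by linarith
  obtain ⟨C, hC⟩ := h
  refine lt_of_le_of_lt (iSup_le fun Q => iSup_le fun hQ => iSup_le fun f => iSup_le fun hf =>
    iSup_le fun hf0 => ?_) (ENNReal.coe_lt_top (r := C))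
  have hle : ∫⁻ x in Q, ‖f x‖ₑ ^ p₁ ∂weightMeasure (dualWeight p₁ w₁) ≤
      eLpNorm f (ENNReal.ofReal p₁) (weightMeasure (dualWeight p₁ w₁)) ^ p₁ := by
    rw [eLpNorm_ofReal_rpow hp₁0]
    exact setLIntegral_le_lintegral _ _
  have hfm : AEMeasurable (fun x => ‖f x‖ₑ) volume :=
    (hf.1.mono_ac (volume_absolutelyContinuous_weightMeasure hσ₁
      (ae_dualWeight_ne_zero hp₁ hw₁))).enorm
  obtain ⟨F₁, hF₁, hF₁ae, hF₁n⟩ := memLp_indicator_mul_dualWeight hp₁ hw₁ hσ₁ hfm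
    (fun x => enorm_ne_top) hQ.measurableSet
    (ne_top_of_le_ne_top (ENNReal.rpow_ne_top_of_nonneg hp₁0.le hf.2.ne) hle)
  have h1 : ∫⁻ x in Q, (1 : ℝ≥0∞) ^ p₂ ∂weightMeasure (dualWeight p₂ w₂) =
      ∫⁻ x in Q, dualWeight p₂ w₂ x := by
    rw [setLIntegral_weightMeasure hσ₂ _ hQ.measurableSet]
    simp
  obtain ⟨F₂, hF₂, hF₂ae, hF₂n⟩ := memLp_indicator_mul_dualWeight (u := fun _ => 1) hp₂ hw₂ hσ₂
    aemeasurable_const (fun x => by simp) hQ.measurableSet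
    (h1 ▸ hσ₂.setLIntegral_ne_top hQ.isCompact)
  simp only [one_mul] at hF₂ae
  have hmain := hC F₁ F₂ hF₁ hF₂
  rw [fracMaximal_congr_ae α hF₁ae hF₂ae, hF₁n, hF₂n, h1, eLpNorm_ofReal_eq hq,
    lintegral_weightMeasure hv] at hmain
  simp only [enorm_eq_self] at hmain
  refine ENNReal.div_le_of_le_mul ?_
  calc _ ≤ _ := ENNReal.rpow_le_rpow ((setLIntegral_le_lintegral _ _).trans_eq
        (lintegral_congr fun x => mul_comm _ _)) (by positivity)
    _ ≤ _ := hmain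
    _ ≤ _ := by
        rw [mul_assoc]
        gcongr
        rw [one_div, ENNReal.rpow_inv_le_iff hp₁0]
        exact hle

end TwoWeight

theorem theorem2 (n : ℕ) (α p₁ p₂ p q : ℝ)
    (hα₀ : 0 ≤ α) (hα : α < 2 * n) (hp₁ : 1 < p₁) (hp₂ : 1 < p₂)
    (hp : 1 / p = 1 / p₁ + 1 / p₂) (hq₀ : 0 < q) (hq : 1 / q = 1 / p - α / n)
    (w₁ w₂ v : (Fin n → ℝ) → ℝ≥0∞)
    (hw₁ : IsWeight w₁) (hw₂ : IsWeight w₂) (hv : IsWeight v)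
    (hσ₁ : IsWeight (dualWeight p₁ w₁)) (hσ₂ : IsWeight (dualWeight p₂ w₂)) :
    FracMaximalBounded α p₁ p₂ q w₁ w₂ v ↔
      testConst₁ α p₁ p₂ q (dualWeight p₁ w₁) (dualWeight p₂ w₂) v < ∞ ∧
      testConst₂ α p₁ p₂ q (dualWeight p₁ w₁) (dualWeight p₂ w₂) v < ∞ := by
  have hn0 : (0 : ℝ) < n := by linarith
  have hn : n ≠ 0 := by rintro rfl; simp at hn0
  have hθ : 0 ≤ 1 - α / (2 * n) := by
    rw [sub_nonneg, div_le_one (by positivity)]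
    exact hα.le
  have hpq : 1 ≤ q / p₁ + q / p₂ := by
    have h1 : 0 ≤ α / n := by positivity
    have h2 : 1 / q ≤ 1 / p₁ + 1 / p₂ := by linarith
    calc 1 = q * (1 / q) := by field_simp
      _ ≤ q * (1 / p₁ + 1 / p₂) := by gcongr
      _ = _ := by ring
  constructor
  · intro h
    refine ⟨?_, h.testConst₂_lt_top hp₁ hp₂ hq₀ hw₁ hw₂ hv hσ₁ hσ₂⟩
    rw [testConst₁_eq_testConst₂]
    exact h.symm.testConst₂_lt_top hp₂ hp₁ hq₀ hw₂ hw₁ hv hσ₂ hσ₁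
  · rintro ⟨h₁, h₂⟩
    exact fracMaximalBounded_of_testConst hn hθ hp₁ hp₂ hq₀ hpq hw₁ hw₂ hv hσ₁ hσ₂ h₁ h₂
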